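/- Let $k\ge 1$ and let $\pi$ be a probability vector on $[k]=\{1,\dots,k\}$ with $\pi_a>0$ for all $a$. Let $S$ be a fixed symmetric $k\times k$ matrix with strictly positive entries and no two identical columns, and let $(\rho_n)$ be a sequence such that the entries of $\rho_nS$ lie in $[0,1]$ and $\rho_n\to0$. For each $n$ let $(Z_n,A_n)$ be generated by the stochastic block model with parameters $(k,\pi,\rho_nS)$: $Z_n=(Z_1,\dots,Z_n)$ has i.i.d. entries with law $\pi$ and, given $Z_n=z$, $A_n$ is the adjacency matrix of an undirected graph without loops on $\{1,\dots,n\}$ whose edges $\{i,j\}$, $i<j$, are independently present with probability $\rho_nS_{z_iz_j}$. For $z\in[k]^n$ and a graph with adjacency matrix $A$ put $n_a(z)=\#\{i:z_i=a\}$, $n_{ab}(z)=n_a(z)n_b(z)$ if $a\ne b$, $n_{aa}(z)=n_a(z)(n_a(z)-1)$, $o_{ab}(z)=\sum_{i,j}\mathbf 1\{z_i=a,z_j=b\}A_{ij}$; let $\tilde n_{ab}=n_{ab}$, $\tilde o_{ab}=o_{ab}$ for $a\neq b$ and $\tilde n_{aa}=n_{aa}/2$, $\tilde o_{aa}=o_{aa}/2$.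 With $\tau(x)=x\log x+(1-x)\log(1-x)$ (where $0\log0=0$; a term with $n_{ab}=0$ is $0$) and $B$ the beta function, let $$Q_{\rm ML}(z)=\frac1{2n^2}\sum_{1\le a,b\le k}n_{ab}(z)\,\tau\!\Big(\frac{o_{ab}(z)}{n_{ab}(z)}\Big),\qquad Q_{\rm ICL}(z)=\frac1{n^2}\sum_{1\le a\le b\le k}\log\frac{B(\tilde o_{ab}(z)+\frac12,\ \tilde n_{ab}(z)-\tilde o_{ab}(z)+\frac12)}{B(\frac12,\frac12)} .$$ For $\alpha>0$ let $\mathcal F(n,\alpha)=\{z\in[k]^n: n_a(z)\ge\alpha n\ \text{for all }a\}$. The ML (respectively ICL) estimator $\hat z_n$ is any maximizer of $Q_{\rm ML}$ (respectively $Q_{\rm ICL}$), computed from $A_n$, over $\mathcal F(n,\alpha)$. An estimator $\hat z_n$ is weakly consistent if for every $\epsilon>0$ $$\mathbb P\Big(\min_{\sigma}\#\{i:\hat z_{n,i}\ne\sigma(Z_i)\}<\epsilon n\Big)\to1\quad(n\to\infty),$$ the minimum being over the permutations $\sigma$ of $[k]$. **Theorem 1.** Assume $n\rho_n\to\infty$.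 (i) If $0<\alpha<\min_a\pi_a$ is fixed, then the ML and the ICL estimators over $\mathcal F(n,\alpha)$ are both weakly consistent. (ii) The same holds for the estimators over $\mathcal F(n,\alpha_n)$ when $\alpha=\alpha_n>0$ varies with $n$ (in particular, decreases with $n$), provided that $\alpha_n\le c$ for all large $n$ and some constant $c<\min_a\pi_a$, and that $\alpha_n\gg(n\rho_n)^{-1/2}$, i.e. $(n\rho_n)^{-1/2}=o(\alpha_n)$. -/

import Mathlib

open Filter Topology MeasureTheory Asymptotics

namespace SBM

noncomputable section

/-- Community assignments of the nodes `Fin n` with labels in `Fin k`. -/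
abbrev Labels (n k : ℕ) : Type := Fin n → Fin k

variable {n k : ℕ}

open Classical in
/-- The conditional probability of the graph `G` given the labels `z`: the edges `{i, j}`, `i < j`,
are independent Bernoulli variables with parameters `P (z i) (z j)`. A graph is identified with its
(symmetric, zero-diagonal, 0-1 valued) adjacency matrix. -/
def condWeight (P : Matrix (Fin k) (Fin k) ℝ) (z : Labels n k) (G : SimpleGraph (Fin n)) : ℝ :=
  ∏ i, ∏ j ∈ Finset.Ioi i, if G.Adj i j then P (z i) (z j) else 1 - P (z i) (z j)

/-- The joint law of `(Z, A)` in the stochastic block model with `n` nodes, label distribution `π`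
and connection matrix `P`: the labels are i.i.d. with law `π`, and given the labels the graph has
the law `condWeight P`. (It is a probability measure when `π` is a probability vector and `P` is
symmetric with entries in `[0, 1]`.) -/
def law (n : ℕ) (π : Fin k → ℝ) (P : Matrix (Fin k) (Fin k) ℝ) :
    Measure (Labels n k × SimpleGraph (Fin n)) :=
  ∑ x : Labels n k × SimpleGraph (Fin n),
    ENNReal.ofReal ((∏ i, π (x.1 i)) * condWeight P x.1 x.2) • Measure.dirac x

/-- `n_a(z)`, the number of nodes with label `a`. -/
def size (z : Labels n k) (a : Fin k) : ℕ := (Finset.univ.filter fun i => z i = a).card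

/-- `n_{ab}(z)`: `n_a n_b` if `a ≠ b` and `n_a (n_a - 1)` if `a = b`. -/
def pairs (z : Labels n k) (a b : Fin k) : ℝ :=
  if a = b then (size z a : ℝ) * ((size z a : ℝ) - 1) else (size z a : ℝ) * (size z b : ℝ)

open Classical in
/-- `o_{ab}(z, G)`: the sum of the adjacency matrix entries over all ordered pairs `(i, j)` with
`z i = a` and `z j = b`. -/
def edges (G : SimpleGraph (Fin n)) (z : Labels n k) (a b : Fin k) : ℝ :=
  ∑ i, ∑ j, if z i = a ∧ z j = b ∧ G.Adj i j then 1 else 0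

/-- `τ(x) = x log x + (1 - x) log (1 - x)`, with `0 log 0 = 0`. -/
def tau (x : ℝ) : ℝ := x * Real.log x + (1 - x) * Real.log (1 - x)

/-- The likelihood modularity. -/
def QML (G : SimpleGraph (Fin n)) (z : Labels n k) : ℝ :=
  1 / (2 * (n : ℝ) ^ 2) * ∑ a, ∑ b, pairs z a b * tau (edges G z a b / pairs z a b)

/-- `ñ_{ab}`: the number of unordered pairs of nodes with labels `{a, b}`. -/
def pairs' (z : Labels n k) (a b : Fin k) : ℝ := if a = b then pairs z a b / 2 else pairs z a b

/-- `õ_{ab}`: the number of edges between nodes with labels `a` and `b`. -/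
def edges' (G : SimpleGraph (Fin n)) (z : Labels n k) (a b : Fin k) : ℝ :=
  if a = b then edges G z a b / 2 else edges G z a b

/-- The integrated conditional likelihood modularity, for independent `Beta(1/2, 1/2)` priors. -/
def QICL (G : SimpleGraph (Fin n)) (z : Labels n k) : ℝ :=
  1 / (n : ℝ) ^ 2 * ∑ a, ∑ b ∈ Finset.Ici a,
    Real.log (ProbabilityTheory.beta (edges' G z a b + 1 / 2)
        (pairs' z a b - edges' G z a b + 1 / 2) / ProbabilityTheory.beta (1 / 2) (1 / 2))

/-- `F(n, α)`: the assignments all of whose communities have at least `α n` nodes. -/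
def feasible (n k : ℕ) (α : ℝ) : Set (Labels n k) := {z | ∀ a, α * (n : ℝ) ≤ (size z a : ℝ)}

/-- `zhat` is an estimator of the labels from the observed graph that maximizes the modularity `Q`
over `F(n, α n)`, ties being broken arbitrarily. (Nothing is asked where `F(n, α n)` is empty.) -/
def IsMaximizer (Q : ∀ n : ℕ, SimpleGraph (Fin n) → Labels n k → ℝ) (α : ℕ → ℝ)
    (zhat : ∀ n : ℕ, SimpleGraph (Fin n) → Labels n k) : Prop :=
  ∀ (n : ℕ) (G : SimpleGraph (Fin n)), (feasible n k (α n)).Nonempty →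
    zhat n G ∈ feasible n k (α n) ∧ IsMaxOn (Q n G) (feasible n k (α n)) (zhat n G)

/-- `zhat` is a maximum conditional likelihood estimator over `F(n, α n)`. -/
def IsMLEstimator (α : ℕ → ℝ) (zhat : ∀ n : ℕ, SimpleGraph (Fin n) → Labels n k) : Prop :=
  IsMaximizer (fun _ G z => QML G z) α zhat

/-- `zhat` is a maximum integrated conditional likelihood estimator over `F(n, α n)`. -/
def IsICLEstimator (α : ℕ → ℝ) (zhat : ∀ n : ℕ, SimpleGraph (Fin n) → Labels n k) : Prop :=
  IsMaximizer (fun _ G z => QICL G z) α zhat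

/-- The number of misclassified nodes, up to a permutation of the labels. -/
def misclassified (e z : Labels n k) : ℕ :=
  ⨅ σ : Equiv.Perm (Fin k), (Finset.univ.filter fun i => e i ≠ σ (z i)).card

/-- Weak consistency of `zhat` under the stochastic block models with parameters `(π, P n)`. -/
def WeaklyConsistent (π : Fin k → ℝ) (P : ℕ → Matrix (Fin k) (Fin k) ℝ)
    (zhat : ∀ n : ℕ, SimpleGraph (Fin n) → Labels n k) : Prop :=
  ∀ ε : ℝ, 0 < ε →
    Tendsto (fun n : ℕ => law n π (P n)
      {x | (misclassified (zhat n x.2) x.1 : ℝ) < ε * (n : ℝ)}) atTop (𝓝 1)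

end

end SBM

/-! Call the cells of an assignment `e` the sets of ordered pairs of nodes whose labels under `e`
are `(a, b)`. Given the true labels `z`, a cell count has as mean `ρ` times the sum of `S (z i) (z
j)` over the cell. A Chernoff bound whose variance proxy is this mean gives relative precision `ε`
with failure probability `exp (-c ρ (α n)^2)`. As `n ρ α^2 → ∞`, this beats the union bound over the
at most `k ^ n` assignments, so concentration is uniform (`law_concentrated_ge`).

On that event expand `τ(x) = x log x - x + O(x^2)` at `x = ρ u`. The dominant part of the likelihood
is `(log ρ - 1)` times the sum of all counts, which does not depend on `e` and cancels. What is
left, at scale `ρ n^2`, is the sum of `u log u` over the cells with `u` replaced by the cell average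
of `S` (`likelihood_approx`). By Jensen this is largest at `z`, and strong convexity of `u log u`
turns a small deficit into a small squared deviation of `S (z i) (z j)` from its average over the
cells of `e` (`popEnergy_add_le`, `sum_sq_le_of_likelihood_le`).

Finally, if a class of `e` contained many nodes of two true classes, then, the columns of `S` being
distinct, `S` would vary on a cell with order `n^2` pairs. So each class of `e` has a large overlap
with at most one true class, which defines the permutation (`misclassified_le_of_sum_sq_le`).

ICL differs from ML only by logarithmic terms, since each log beta ratio equals the maximized
binomial log likelihood up to `O(log n)` (`icl_bounds`). An error of order `n` would still be
harmless, because `n = o(ρ n^2)`. -/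

namespace SBM

/-! ### Sums over graphs and over unordered pairs -/

section Graphs

-- Expanding the right side chooses one term for each pair `i < j`, that is, a set of pairs, that
-- is, a graph. This is the independence of the edges: it gives total mass one and makes moment
-- generating functions factorize.
open Classical in
theorem sum_simpleGraph_prod {n : ℕ} (f g : Fin n → Fin n → ℝ) :
    ∑ G : SimpleGraph (Fin n), ∏ i, ∏ j ∈ Finset.Ioi i, (if G.Adj i j then f i j else g i j) =
      ∏ i, ∏ j ∈ Finset.Ioi i, (f i j + g i j) := by
  simp_rw [Finset.prod_sigma']
  rw [Finset.prod_add]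
  set s : Finset (Σ _ : Fin n, Fin n) := Finset.univ.sigma fun i => Finset.Ioi i with hs
  have mem_s : ∀ p : Σ _ : Fin n, Fin n, p ∈ s ↔ p.1 < p.2 := by
    intro p
    simp [hs]
  refine Finset.sum_bij' (fun G _ => s.filter fun p => G.Adj p.1 p.2)
    (fun t _ => SimpleGraph.fromRel fun i j => i < j ∧ (⟨i, j⟩ : Σ _ : Fin n, Fin n) ∈ t)
    ?_ ?_ ?_ ?_ ?_
  · intro G _
    simp [Finset.filter_subset]
  · intro t _
    exact Finset.mem_univ _
  · intro G _
    ext i j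
    simp only [SimpleGraph.fromRel_adj, Finset.mem_filter, mem_s]
    constructor
    · rintro ⟨_, h | h⟩
      · exact h.2.2
      · exact h.2.2.symm
    · intro h
      refine ⟨h.ne, ?_⟩
      rcases lt_or_gt_of_ne h.ne with h' | h'
      · exact Or.inl ⟨h', h', h⟩
      · exact Or.inr ⟨h', h', h.symm⟩
  · intro t ht
    rw [Finset.mem_powerset] at ht
    ext ⟨i, j⟩
    simp only [SimpleGraph.fromRel_adj, Finset.mem_filter, mem_s]
    constructor
    · rintro ⟨h, _, h' | h'⟩
      · exact h'.2
      · exact absurd h'.1 h.asymm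
    · intro h
      have := (mem_s _).1 (ht h)
      exact ⟨this, ne_of_lt this, Or.inl ⟨this, h⟩⟩
  · intro G _
    rw [← Finset.prod_filter_mul_prod_filter_not s (fun p => G.Adj p.1 p.2)]
    congr 1
    · refine Finset.prod_congr rfl fun p hp => ?_
      rw [if_pos (Finset.mem_filter.1 hp).2]
    · rw [Finset.filter_not]
      refine Finset.prod_congr rfl fun p hp => ?_
      rw [Finset.mem_sdiff, Finset.mem_filter, not_and] at hp
      rw [if_neg (hp.2 hp.1)]

theorem sum_sum_eq_sum_Ioi {n : ℕ} (f : Fin n → Fin n → ℝ) (hf : ∀ i, f i i = 0) :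
    ∑ i, ∑ j, f i j = ∑ i, ∑ j ∈ Finset.Ioi i, (f i j + f j i) := by
  have h : ∀ i j, f i j = (if i < j then f i j else 0) + (if j < i then f i j else 0) := by
    intro i j
    rcases lt_trichotomy i j with h | h | h
    · simp [h, h.asymm]
    · subst h; simp [hf]
    · simp [h, h.asymm]
  have hI : ∀ i : Fin n, Finset.Ioi i = Finset.univ.filter fun j => i < j := by
    intro i; ext j; simp
  simp_rw [hI, Finset.sum_filter, ite_add_zero, Finset.sum_add_distrib]
  rw [Finset.sum_comm (f := fun i j => if i < j then f j i else 0), ← Finset.sum_add_distrib]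
  refine Finset.sum_congr rfl fun i _ => ?_
  rw [← Finset.sum_add_distrib]
  exact Finset.sum_congr rfl fun j _ => h i j

end Graphs

/-! ### The law as a finite sum of weights -/

section Law

variable {n k : ℕ} {P : Matrix (Fin k) (Fin k) ℝ}

theorem condWeight_nonneg (h0 : ∀ a b, 0 ≤ P a b) (h1 : ∀ a b, P a b ≤ 1)
    (z : Labels n k) (G : SimpleGraph (Fin n)) : 0 ≤ condWeight P z G := by
  refine Finset.prod_nonneg fun i _ => Finset.prod_nonneg fun j _ => ?_
  split_ifs
  · exact h0 _ _
  · linarith [h1 (z i) (z j)]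

theorem sum_condWeight (z : Labels n k) : ∑ G, condWeight P z G = 1 := by
  unfold condWeight
  rw [sum_simpleGraph_prod]
  simp

theorem sum_prod_labels (π : Fin k → ℝ) (hπ : ∑ a, π a = 1) :
    ∑ z : Labels n k, ∏ i, π (z i) = 1 := by
  rw [← Fintype.sum_pow, hπ, one_pow]

theorem sum_weight (π : Fin k → ℝ) (hπ : ∑ a, π a = 1) :
    ∑ x : Labels n k × SimpleGraph (Fin n), (∏ i, π (x.1 i)) * condWeight P x.1 x.2 = 1 := by
  rw [Fintype.sum_prod_type]
  simp_rw [← Finset.mul_sum, sum_condWeight, mul_one]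
  exact sum_prod_labels π hπ

theorem law_univ {π : Fin k → ℝ} (hπ0 : ∀ a, 0 ≤ π a) (hπ : ∑ a, π a = 1)
    (h0 : ∀ a b, 0 ≤ P a b) (h1 : ∀ a b, P a b ≤ 1) : law n π P Set.univ = 1 := by
  simp only [law, Measure.coe_finsetSum, Finset.sum_apply, Measure.smul_apply, smul_eq_mul,
    measure_univ, mul_one]
  rw [← ENNReal.ofReal_sum_of_nonneg, sum_weight π hπ, ENNReal.ofReal_one]
  exact fun x _ => mul_nonneg (Finset.prod_nonneg fun i _ => hπ0 _) (condWeight_nonneg h0 h1 _ _)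

-- Bounds on the complement, computed as finite sums, become lower bounds on the measure. The
-- inequality for Dirac masses used here needs no measurability of `E`.
open Classical in
theorem ofReal_le_law {π : Fin k → ℝ} (hπ0 : ∀ a, 0 ≤ π a) (hπ : ∑ a, π a = 1)
    (h0 : ∀ a b, 0 ≤ P a b) (h1 : ∀ a b, P a b ≤ 1)
    (E : Set (Labels n k × SimpleGraph (Fin n))) {δ : ℝ}
    (hδ : ∑ x : Labels n k × SimpleGraph (Fin n),
      (∏ i, π (x.1 i)) * condWeight P x.1 x.2 * (if x ∈ E then 0 else 1) ≤ δ) :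
    ENNReal.ofReal (1 - δ) ≤ law n π P E := by
  have hw : ∀ x : Labels n k × SimpleGraph (Fin n),
      0 ≤ (∏ i, π (x.1 i)) * condWeight P x.1 x.2 := fun x =>
    mul_nonneg (Finset.prod_nonneg fun i _ => hπ0 _) (condWeight_nonneg h0 h1 _ _)
  have key : 1 - δ ≤ ∑ x : Labels n k × SimpleGraph (Fin n),
      (∏ i, π (x.1 i)) * condWeight P x.1 x.2 * (if x ∈ E then 1 else 0) := by
    have hsum : (∑ x : Labels n k × SimpleGraph (Fin n),
        (∏ i, π (x.1 i)) * condWeight P x.1 x.2 * (if x ∈ E then 0 else 1)) +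
        ∑ x : Labels n k × SimpleGraph (Fin n),
          (∏ i, π (x.1 i)) * condWeight P x.1 x.2 * (if x ∈ E then 1 else 0) = 1 := by
      rw [← Finset.sum_add_distrib]
      refine (Finset.sum_congr rfl fun x _ => ?_).trans (sum_weight (n := n) (P := P) π hπ)
      split_ifs <;> simp
    linarith
  refine (ENNReal.ofReal_le_ofReal key).trans ?_
  rw [ENNReal.ofReal_sum_of_nonneg
    (fun x _ => mul_nonneg (hw x) (by split_ifs <;> norm_num))]
  simp only [law, Measure.coe_finsetSum, Finset.sum_apply, Measure.smul_apply, smul_eq_mul]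
  refine Finset.sum_le_sum fun x _ => ?_
  by_cases hx : x ∈ E
  · rw [if_pos hx, mul_one]
    refine le_trans ?_ (mul_le_mul_right Measure.le_dirac_apply _)
    simp [hx]
  · simp [hx]

end Law

/-! ### Chernoff bounds for edge counts and class sizes -/

section Tails

variable {n k : ℕ}

theorem exp_le_one_add_add_sq {u : ℝ} (hu : |u| ≤ 1) : Real.exp u ≤ 1 + u + u ^ 2 := by
  have := (abs_le.1 (Real.abs_exp_sub_one_sub_id_le hu)).2
  linarith

/-- The factor `p` in the exponent is essential: a Hoeffding bound, blind to the variance, would be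
too weak for sparse graphs. -/
theorem bernoulli_mgf_le {p u : ℝ} (hp : 0 ≤ p) (hu : |u| ≤ 1) :
    p * Real.exp (u * (1 - p)) + (1 - p) * Real.exp (u * (0 - p)) ≤ Real.exp (p * u ^ 2) := by
  have h1 : Real.exp (u * (1 - p)) = Real.exp u * Real.exp (-(u * p)) := by
    rw [← Real.exp_add]; congr 1; ring
  have h2 : Real.exp (u * (0 - p)) = Real.exp (-(u * p)) := by congr 1; ring
  have h3 : Real.exp (p * u ^ 2) = Real.exp (p * (u + u ^ 2)) * Real.exp (-(u * p)) := by
    rw [← Real.exp_add]; congr 1; ring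
  rw [h1, h2, h3, ← mul_assoc, ← add_mul]
  refine mul_le_mul_of_nonneg_right ?_ (Real.exp_pos _).le
  have h4 := Real.add_one_le_exp (p * (u + u ^ 2))
  nlinarith [mul_le_mul_of_nonneg_left (exp_le_one_add_add_sq hu) hp]

open Classical in
theorem sum_condWeight_mul_exp_le {P : Matrix (Fin k) (Fin k) ℝ}
    (h0 : ∀ a b, 0 ≤ P a b) (h1 : ∀ a b, P a b ≤ 1) (z : Labels n k)
    (c : Fin n → Fin n → ℝ) (hc : ∀ i j, |c i j| ≤ 1) :
    ∑ G : SimpleGraph (Fin n), condWeight P z G * Real.exp (∑ i, ∑ j ∈ Finset.Ioi i,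
        c i j * ((if G.Adj i j then 1 else 0) - P (z i) (z j))) ≤
      Real.exp (∑ i, ∑ j ∈ Finset.Ioi i, P (z i) (z j) * c i j ^ 2) := by
  unfold condWeight
  simp_rw [Real.exp_sum, ← Finset.prod_mul_distrib]
  have : ∀ (G : SimpleGraph (Fin n)) (i j : Fin n),
      (if G.Adj i j then P (z i) (z j) else 1 - P (z i) (z j)) *
        Real.exp (c i j * ((if G.Adj i j then 1 else 0) - P (z i) (z j))) =
      if G.Adj i j then P (z i) (z j) * Real.exp (c i j * (1 - P (z i) (z j)))
      else (1 - P (z i) (z j)) * Real.exp (c i j * (0 - P (z i) (z j))) := by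
    intro G i j
    split_ifs <;> rfl
  simp_rw [this]
  rw [sum_simpleGraph_prod]
  have hnn : ∀ i j : Fin n, 0 ≤ P (z i) (z j) * Real.exp (c i j * (1 - P (z i) (z j))) +
      (1 - P (z i) (z j)) * Real.exp (c i j * (0 - P (z i) (z j))) := fun i j =>
    add_nonneg (mul_nonneg (h0 _ _) (Real.exp_pos _).le)
      (mul_nonneg (by linarith [h1 (z i) (z j)]) (Real.exp_pos _).le)
  refine Finset.prod_le_prod (fun i _ => Finset.prod_nonneg fun j _ => hnn i j) fun i _ => ?_
  exact Finset.prod_le_prod (fun j _ => hnn i j) fun j _ => bernoulli_mgf_le (h0 _ _) (hc i j)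

/-- The sum of the entries of `P (z i) (z j)` over the ordered pairs `i ≠ j` with `e i = a` and
`e j = b`: the conditional mean of `edges G e a b` given the labels `z`. -/
noncomputable def expEdges (P : Matrix (Fin k) (Fin k) ℝ) (e z : Labels n k) (a b : Fin k) : ℝ :=
  ∑ i, ∑ j, if e i = a ∧ e j = b ∧ i ≠ j then P (z i) (z j) else 0

/-- How often the unordered pair `{i, j}` contributes to the cell `(a, b)`. -/
noncomputable def cellMult (e : Labels n k) (a b : Fin k) (i j : Fin n) : ℝ :=
  (if e i = a ∧ e j = b then 1 else 0) + (if e j = a ∧ e i = b then 1 else 0)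

theorem cellMult_nonneg (e : Labels n k) (a b : Fin k) (i j : Fin n) : 0 ≤ cellMult e a b i j := by
  unfold cellMult
  split_ifs <;> norm_num

theorem cellMult_le (e : Labels n k) (a b : Fin k) (i j : Fin n) : cellMult e a b i j ≤ 2 := by
  unfold cellMult
  split_ifs <;> norm_num

open Classical in
theorem edges_eq_sum_cellMult (G : SimpleGraph (Fin n)) (e : Labels n k) (a b : Fin k) :
    edges G e a b =
      ∑ i, ∑ j ∈ Finset.Ioi i, cellMult e a b i j * (if G.Adj i j then 1 else 0) := by
  unfold edges
  rw [sum_sum_eq_sum_Ioi _ (by simp)]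
  refine Finset.sum_congr rfl fun i _ => Finset.sum_congr rfl fun j _ => ?_
  unfold cellMult
  rw [G.adj_comm j i]
  by_cases h : G.Adj i j <;> simp [h]

theorem expEdges_eq_sum_cellMult {P : Matrix (Fin k) (Fin k) ℝ} (hP : P.IsSymm)
    (e z : Labels n k) (a b : Fin k) :
    expEdges P e z a b =
      ∑ i, ∑ j ∈ Finset.Ioi i, cellMult e a b i j * P (z i) (z j) := by
  unfold expEdges
  rw [sum_sum_eq_sum_Ioi _ (by simp)]
  refine Finset.sum_congr rfl fun i _ => Finset.sum_congr rfl fun j hj => ?_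
  have hij : i ≠ j := (Finset.mem_Ioi.1 hj).ne
  unfold cellMult
  rw [hP.apply]
  simp [hij, hij.symm, add_mul]

/-- A diagonal cell counts each edge twice. Multiplicities are thus at most `2`, which forces `|u| ≤
1 / 2`, and their squares are at most twice themselves, which gives the factor `2`. -/
theorem sum_condWeight_mul_exp_edges_le {P : Matrix (Fin k) (Fin k) ℝ} (hP : P.IsSymm)
    (h0 : ∀ a b, 0 ≤ P a b) (h1 : ∀ a b, P a b ≤ 1) (e z : Labels n k) (a b : Fin k)
    {u : ℝ} (hu : |u| ≤ 1 / 2) :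
    ∑ G : SimpleGraph (Fin n), condWeight P z G *
        Real.exp (u * (edges G e a b - expEdges P e z a b)) ≤
      Real.exp (2 * u ^ 2 * expEdges P e z a b) := by
  have h := sum_condWeight_mul_exp_le h0 h1 z (fun i j => u * cellMult e a b i j) (by
    intro i j
    rw [abs_mul, abs_of_nonneg (cellMult_nonneg e a b i j)]
    have := cellMult_le e a b i j
    have := cellMult_nonneg e a b i j
    nlinarith [abs_nonneg u])
  refine (le_of_eq ?_).trans (h.trans ?_)
  · refine Finset.sum_congr rfl fun G _ => ?_
    congr 2
    rw [edges_eq_sum_cellMult, expEdges_eq_sum_cellMult hP, ← Finset.sum_sub_distrib,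
      Finset.mul_sum]
    refine Finset.sum_congr rfl fun i _ => ?_
    rw [← Finset.sum_sub_distrib, Finset.mul_sum]
    refine Finset.sum_congr rfl fun j _ => ?_
    ring
  · rw [Real.exp_le_exp, expEdges_eq_sum_cellMult hP, Finset.mul_sum]
    refine Finset.sum_le_sum fun i _ => ?_
    rw [Finset.mul_sum]
    refine Finset.sum_le_sum fun j _ => ?_
    have h2 := cellMult_le e a b i j
    have h3 := cellMult_nonneg e a b i j
    have h4 : cellMult e a b i j ^ 2 ≤ 2 * cellMult e a b i j := by nlinarith
    have h5 : 0 ≤ P (z i) (z j) * u ^ 2 := mul_nonneg (h0 _ _) (sq_nonneg _)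
    nlinarith [mul_le_mul_of_nonneg_left h4 h5]

open Classical in
theorem edges_tail_le {P : Matrix (Fin k) (Fin k) ℝ} (hP : P.IsSymm)
    (h0 : ∀ a b, 0 ≤ P a b) (h1 : ∀ a b, P a b ≤ 1) (e z : Labels n k) (a b : Fin k)
    {u : ℝ} (hu0 : 0 ≤ u) (hu : u ≤ 1 / 2) (t : ℝ) :
    ∑ G : SimpleGraph (Fin n), condWeight P z G *
        (if t < |edges G e a b - expEdges P e z a b| then 1 else 0) ≤
      2 * Real.exp (2 * u ^ 2 * expEdges P e z a b - u * t) := by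
  have hA := sum_condWeight_mul_exp_edges_le hP h0 h1 e z a b (u := u) (by rwa [abs_of_nonneg hu0])
  have hB := sum_condWeight_mul_exp_edges_le hP h0 h1 e z a b (u := -u)
    (by rwa [abs_neg, abs_of_nonneg hu0])
  rw [neg_sq] at hB
  have hs := mul_le_mul_of_nonneg_right (add_le_add hA hB) (Real.exp_pos (-(u * t))).le
  rw [← two_mul, mul_assoc, ← Real.exp_add, ← sub_eq_add_neg] at hs
  refine le_trans ?_ hs
  rw [← Finset.sum_add_distrib, Finset.sum_mul]
  refine Finset.sum_le_sum fun G _ => ?_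
  rw [← mul_add, mul_assoc]
  refine mul_le_mul_of_nonneg_left ?_ (condWeight_nonneg h0 h1 z G)
  rw [add_mul, ← Real.exp_add, ← Real.exp_add]
  have p1 := Real.exp_pos (u * (edges G e a b - expEdges P e z a b) + -(u * t))
  have p2 := Real.exp_pos (-u * (edges G e a b - expEdges P e z a b) + -(u * t))
  split_ifs with h
  · rcases lt_abs.1 h with h | h
    · have := Real.one_le_exp (x := u * (edges G e a b - expEdges P e z a b) + -(u * t))
        (by nlinarith)
      linarith
    · have := Real.one_le_exp (x := -u * (edges G e a b - expEdges P e z a b) + -(u * t))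
        (by nlinarith)
      linarith
  · linarith

open Classical in
theorem size_tail_le {π : Fin k → ℝ} (hπ0 : ∀ a, 0 ≤ π a) (hπ : ∑ a, π a = 1) (a : Fin k)
    {c : ℝ} (hc0 : 0 ≤ c) (hc : c < π a) :
    ∑ z : Labels n k, (∏ i, π (z i)) * (if (size z a : ℝ) < c * n then 1 else 0) ≤
      Real.exp (-(π a - c) ^ 2 / 4) ^ n := by
  have hπ1 : π a ≤ 1 := by
    rw [← hπ]
    exact Finset.single_le_sum (fun b _ => hπ0 b) (Finset.mem_univ a)
  -- With `d = π a - c` the exponent per node is at most `-u d + u ^ 2`, minimal at `u = d / 2`.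
  set u := (π a - c) / 2 with hu
  have hu0 : 0 ≤ u := by rw [hu]; linarith
  have hu1 : u ≤ 1 := by rw [hu]; linarith
  have hfac : ∑ b, π b * Real.exp (u * (c - if b = a then 1 else 0)) ≤
      Real.exp (-(π a - c) ^ 2 / 4) := by
    have h1 : ∑ b, π b * Real.exp (u * (c - if b = a then 1 else 0)) =
        Real.exp (u * c) * (1 + π a * (Real.exp (-u) - 1)) := by
      have : ∀ b, π b * Real.exp (u * (c - if b = a then 1 else 0)) =
          Real.exp (u * c) * (π b + if b = a then π b * (Real.exp (-u) - 1) else 0) := by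
        intro b
        split_ifs
        · rw [show u * (c - 1) = u * c + -u by ring, Real.exp_add]; ring
        · rw [sub_zero]; ring
      simp_rw [this]
      rw [← Finset.mul_sum, Finset.sum_add_distrib, hπ]
      simp
    have h2 := exp_le_one_add_add_sq (u := -u) (by rwa [abs_neg, abs_of_nonneg hu0])
    have h3 := Real.add_one_le_exp (π a * (-u + u ^ 2))
    have h4 : 1 + π a * (Real.exp (-u) - 1) ≤ Real.exp (π a * (-u + u ^ 2)) := by
      nlinarith [mul_le_mul_of_nonneg_left h2 (hπ0 a)]
    rw [h1]
    refine (mul_le_mul_of_nonneg_left h4 (Real.exp_pos _).le).trans ?_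
    rw [← Real.exp_add, Real.exp_le_exp]
    have : π a * u ^ 2 ≤ u ^ 2 := by nlinarith [sq_nonneg u]
    have e1 : π a - c = 2 * u := by rw [hu]; ring
    rw [e1]
    nlinarith
  have hfac0 : 0 ≤ ∑ b, π b * Real.exp (u * (c - if b = a then 1 else 0)) :=
    Finset.sum_nonneg fun b _ => mul_nonneg (hπ0 b) (Real.exp_pos _).le
  refine le_trans ?_ (pow_le_pow_left₀ hfac0 hfac n)
  rw [Fintype.sum_pow]
  refine Finset.sum_le_sum fun z _ => ?_
  rw [Finset.prod_mul_distrib]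
  refine mul_le_mul_of_nonneg_left ?_ (Finset.prod_nonneg fun i _ => hπ0 _)
  rw [← Real.exp_sum, ← Finset.mul_sum, Finset.sum_sub_distrib]
  have hsz : ∑ i, (if z i = a then (1 : ℝ) else 0) = size z a := by
    rw [size, Finset.sum_boole]
  rw [hsz]
  simp only [Finset.sum_const, Finset.card_univ, Fintype.card_fin, nsmul_eq_mul]
  split_ifs with h
  · exact Real.one_le_exp (mul_nonneg hu0 (by linarith))
  · exact (Real.exp_pos _).le

end Tails

/-! ### Cells as sets of ordered pairs of nodes -/

section Pairs

variable {n k : ℕ}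

theorem sum_boole_eq_size (e : Labels n k) (a : Fin k) :
    ∑ i, (if e i = a then (1 : ℝ) else 0) = size e a := by
  rw [size, Finset.sum_boole]

theorem pairs_eq_sum (e : Labels n k) (a b : Fin k) :
    pairs e a b = ∑ i, ∑ j, if e i = a ∧ e j = b ∧ i ≠ j then (1 : ℝ) else 0 := by
  have h1 : ∀ i j : Fin n, (if e i = a ∧ e j = b ∧ i ≠ j then (1 : ℝ) else 0) =
      (if e i = a then 1 else 0) * (if e j = b then 1 else 0) -
        if i = j then (if e i = a ∧ e i = b then 1 else 0) else 0 := by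
    intro i j
    by_cases hij : i = j
    · subst hij
      by_cases ha : e i = a <;> by_cases hb : e i = b <;> simp [ha, hb]
    · by_cases ha : e i = a <;> by_cases hb : e j = b <;> simp [ha, hb, hij]
  simp_rw [h1, Finset.sum_sub_distrib, ← Finset.mul_sum, ← Finset.sum_mul, sum_boole_eq_size]
  unfold pairs
  split_ifs with hab
  · subst hab
    simp [size]
    ring
  · have : ∀ i, ¬ (e i = a ∧ e i = b) := fun i h => hab (h.1.symm.trans h.2)
    simp [this]

theorem pairs_nonneg (e : Labels n k) (a b : Fin k) : 0 ≤ pairs e a b := by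
  rw [pairs_eq_sum]
  exact Finset.sum_nonneg fun i _ => Finset.sum_nonneg fun j _ => by split_ifs <;> norm_num

theorem le_pairs {e : Labels n k} {s : ℝ} (hs : 2 ≤ s) (he : ∀ a, s ≤ size e a) (a b : Fin k) :
    s ^ 2 / 2 ≤ pairs e a b := by
  have ha := he a
  have hb := he b
  unfold pairs
  split_ifs <;> nlinarith

/-- The cells of `e` partition the ordered pairs, so a sum over cells does not remember `e`. -/
theorem sum_cells (e : Labels n k) (r : Fin n → Fin n → Prop) [∀ i j, Decidable (r i j)]
    (f : Fin n → Fin n → ℝ) :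
    ∑ a, ∑ b, ∑ i, ∑ j, (if e i = a ∧ e j = b ∧ r i j then f i j else 0) =
      ∑ i, ∑ j, if r i j then f i j else 0 := by
  calc _ = ∑ a, ∑ i, ∑ j, ∑ b, (if e i = a ∧ e j = b ∧ r i j then f i j else 0) := by
        refine Finset.sum_congr rfl fun a _ => ?_
        rw [Finset.sum_comm]
        exact Finset.sum_congr rfl fun i _ => Finset.sum_comm
    _ = ∑ i, ∑ j, ∑ a, ∑ b, (if e i = a ∧ e j = b ∧ r i j then f i j else 0) := by
        rw [Finset.sum_comm]
        exact Finset.sum_congr rfl fun i _ => Finset.sum_comm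
    _ = _ := by
        refine Finset.sum_congr rfl fun i _ => Finset.sum_congr rfl fun j _ => ?_
        simp [ite_and]

theorem sum_pairs_le (e : Labels n k) : ∑ a, ∑ b, pairs e a b ≤ (n : ℝ) ^ 2 := by
  simp_rw [pairs_eq_sum]
  rw [sum_cells e (fun i j => i ≠ j) (fun _ _ => 1)]
  calc _ ≤ ∑ i : Fin n, ∑ j : Fin n, (1 : ℝ) :=
        Finset.sum_le_sum fun i _ => Finset.sum_le_sum fun j _ => by split_ifs <;> norm_num
    _ = _ := by simp [sq]

theorem le_expEdges {P : Matrix (Fin k) (Fin k) ℝ} {m : ℝ} (h : ∀ a b, m ≤ P a b)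
    (e z : Labels n k) (a b : Fin k) : m * pairs e a b ≤ expEdges P e z a b := by
  rw [pairs_eq_sum, expEdges, Finset.mul_sum]
  refine Finset.sum_le_sum fun i _ => ?_
  rw [Finset.mul_sum]
  refine Finset.sum_le_sum fun j _ => ?_
  split_ifs
  · simpa using h _ _
  · simp

theorem expEdges_le {P : Matrix (Fin k) (Fin k) ℝ} {M : ℝ} (h : ∀ a b, P a b ≤ M)
    (e z : Labels n k) (a b : Fin k) : expEdges P e z a b ≤ M * pairs e a b := by
  rw [pairs_eq_sum, expEdges, Finset.mul_sum]
  refine Finset.sum_le_sum fun i _ => ?_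
  rw [Finset.mul_sum]
  refine Finset.sum_le_sum fun j _ => ?_
  split_ifs
  · simpa using h _ _
  · simp

theorem expEdges_smul (r : ℝ) (P : Matrix (Fin k) (Fin k) ℝ) (e z : Labels n k) (a b : Fin k) :
    expEdges (r • P) e z a b = r * expEdges P e z a b := by
  unfold expEdges
  rw [Finset.mul_sum]
  refine Finset.sum_congr rfl fun i _ => ?_
  rw [Finset.mul_sum]
  refine Finset.sum_congr rfl fun j _ => ?_
  split_ifs <;> simp

end Pairs

/-! ### Uniform concentration over assignments -/

section Concentration

variable {n k : ℕ}

/-- Uniformly over the assignments in `F`, the edge counts of all cells are within relative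
precision of order `ε` of their conditional means given the labels `z`. -/
def Concentrated (S : Matrix (Fin k) (Fin k) ℝ) (r ε : ℝ) (F : Set (Labels n k))
    (z : Labels n k) (G : SimpleGraph (Fin n)) : Prop :=
  ∀ e ∈ F, ∀ a b, |edges G e a b - r * expEdges S e z a b| ≤ ε * r * pairs e a b

open Classical in
theorem edges_tail_le_exp {S : Matrix (Fin k) (Fin k) ℝ} {r M ε s : ℝ} (hS : S.IsSymm)
    (h0 : ∀ a b, 0 ≤ r * S a b) (h1 : ∀ a b, r * S a b ≤ 1) (hr : 0 ≤ r) (hM : 0 < M)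
    (hSM : ∀ a b, S a b ≤ M) (hε : 0 < ε) (hs : 2 ≤ s) (e z : Labels n k)
    (he : ∀ a, s ≤ size e a) (a b : Fin k) :
    ∑ G : SimpleGraph (Fin n), condWeight (r • S) z G *
        (if ε * r * pairs e a b < |edges G e a b - r * expEdges S e z a b| then 1 else 0) ≤
      2 * Real.exp (-(min (1 / 2) (ε / (4 * M)) * ε / 4 * (r * s ^ 2))) := by
  -- The bound `1 / 2` is the range of the Chernoff bound; `ε / (4 * M)` keeps the variance term
  -- below half of the linear term `u * ε * r * pairs e a b`.
  set u := min (1 / 2) (ε / (4 * M)) with hu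
  have hu0 : 0 < u := lt_min (by norm_num) (by positivity)
  have hu2 : 4 * M * u ≤ ε := by
    have := min_le_right (1 / 2) (ε / (4 * M))
    rw [← hu, le_div_iff₀ (by positivity)] at this
    linarith
  have h := edges_tail_le (P := r • S) (hS.smul r) h0 h1 e z a b hu0.le
    (min_le_left _ _) (ε * r * pairs e a b)
  rw [expEdges_smul] at h
  refine h.trans (mul_le_mul_of_nonneg_left (Real.exp_le_exp.2 ?_) (by norm_num))
  have hp := le_pairs hs he a b
  have hm := expEdges_le hSM e z a b
  have hp0 := pairs_nonneg e a b
  have e1 : r * expEdges S e z a b ≤ r * (M * pairs e a b) := mul_le_mul_of_nonneg_left hm hr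
  have e2 : 2 * u ^ 2 * (r * expEdges S e z a b) ≤ u * ε / 2 * (r * pairs e a b) := by
    calc 2 * u ^ 2 * (r * expEdges S e z a b) ≤ 2 * u ^ 2 * (r * (M * pairs e a b)) :=
          mul_le_mul_of_nonneg_left e1 (by positivity)
      _ = (4 * M * u) * (u / 2 * (r * pairs e a b)) := by ring
      _ ≤ ε * (u / 2 * (r * pairs e a b)) := mul_le_mul_of_nonneg_right hu2 (by positivity)
      _ = _ := by ring
  have e3 : u * ε / 4 * (r * s ^ 2) ≤ u * ε / 2 * (r * pairs e a b) := by
    calc u * ε / 4 * (r * s ^ 2) = u * ε / 2 * (r * (s ^ 2 / 2)) := by ring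
      _ ≤ _ := mul_le_mul_of_nonneg_left (mul_le_mul_of_nonneg_left hp hr) (by positivity)
  linarith

-- Union bound over at most `k ^ n` assignments and `k ^ 2` cells.
open Classical in
theorem not_concentrated_le {S : Matrix (Fin k) (Fin k) ℝ} {r M ε s : ℝ} (hS : S.IsSymm)
    (h0 : ∀ a b, 0 ≤ r * S a b) (h1 : ∀ a b, r * S a b ≤ 1) (hr : 0 ≤ r) (hM : 0 < M)
    (hSM : ∀ a b, S a b ≤ M) (hε : 0 < ε) (hs : 2 ≤ s) {F : Set (Labels n k)}
    (hF : ∀ e ∈ F, ∀ a, s ≤ size e a) (z : Labels n k) :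
    ∑ G : SimpleGraph (Fin n), condWeight (r • S) z G *
        (if Concentrated S r ε F z G then 0 else 1) ≤
      (k : ℝ) ^ n * (k ^ 2 *
        (2 * Real.exp (-(min (1 / 2) (ε / (4 * M)) * ε / 4 * (r * s ^ 2))))) := by
  set B := 2 * Real.exp (-(min (1 / 2) (ε / (4 * M)) * ε / 4 * (r * s ^ 2))) with hB
  have hB0 : 0 ≤ B := by positivity
  set X : SimpleGraph (Fin n) → Labels n k → Fin k → Fin k → ℝ := fun G e a b =>
    if e ∈ F then
      (if ε * r * pairs e a b < |edges G e a b - r * expEdges S e z a b| then 1 else 0)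
    else 0 with hX
  have hX0 : ∀ G e a b, 0 ≤ X G e a b := by
    intro G e a b
    simp only [hX]
    split_ifs <;> norm_num
  have step : ∀ G : SimpleGraph (Fin n), (if Concentrated S r ε F z G then (0 : ℝ) else 1) ≤
      ∑ e, ∑ a, ∑ b, X G e a b := by
    intro G
    have hnn : 0 ≤ ∑ e, ∑ a, ∑ b, X G e a b := Finset.sum_nonneg fun e _ =>
      Finset.sum_nonneg fun a _ => Finset.sum_nonneg fun b _ => hX0 G e a b
    split_ifs with hc
    · exact hnn
    · simp only [Concentrated, not_forall, not_le] at hc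
      obtain ⟨e, he, a, b, hab⟩ := hc
      calc (1 : ℝ) = X G e a b := by simp [hX, he, hab]
        _ ≤ ∑ b, X G e a b :=
          Finset.single_le_sum (fun b _ => hX0 G e a b) (Finset.mem_univ b)
        _ ≤ ∑ a, ∑ b, X G e a b := Finset.single_le_sum (f := fun a => ∑ b, X G e a b)
          (fun a _ => Finset.sum_nonneg fun b _ => hX0 G e a b) (Finset.mem_univ a)
        _ ≤ _ := Finset.single_le_sum (f := fun e => ∑ a, ∑ b, X G e a b)
          (fun e _ => Finset.sum_nonneg fun a _ => Finset.sum_nonneg fun b _ => hX0 G e a b)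
          (Finset.mem_univ e)
  calc _ ≤ ∑ G : SimpleGraph (Fin n), condWeight (r • S) z G * ∑ e, ∑ a, ∑ b, X G e a b :=
        Finset.sum_le_sum fun G _ => mul_le_mul_of_nonneg_left (step G)
          (condWeight_nonneg h0 h1 z G)
    _ = ∑ e, ∑ a, ∑ b, ∑ G : SimpleGraph (Fin n), condWeight (r • S) z G * X G e a b := by
        simp_rw [Finset.mul_sum]
        rw [Finset.sum_comm]
        refine Finset.sum_congr rfl fun e _ => ?_
        rw [Finset.sum_comm]
        exact Finset.sum_congr rfl fun a _ => Finset.sum_comm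
    _ ≤ ∑ e : Labels n k, ∑ a : Fin k, ∑ b : Fin k, B := by
        refine Finset.sum_le_sum fun e _ => Finset.sum_le_sum fun a _ =>
          Finset.sum_le_sum fun b _ => ?_
        by_cases he : e ∈ F
        · simp only [hX, if_pos he]
          exact edges_tail_le_exp hS h0 h1 hr hM hSM hε hs e z (hF e he) a b
        · simpa [hX, he] using hB0
    _ = _ := by
        simp only [Finset.sum_const, Finset.card_univ, Fintype.card_fun, Fintype.card_fin,
          nsmul_eq_mul, Nat.cast_pow]
        ring

theorem sum_weight_mul_add {P : Matrix (Fin k) (Fin k) ℝ} (π : Fin k → ℝ) (f : Labels n k → ℝ)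
    (g : Labels n k → SimpleGraph (Fin n) → ℝ) :
    ∑ x : Labels n k × SimpleGraph (Fin n),
        (∏ i, π (x.1 i)) * condWeight P x.1 x.2 * (f x.1 + g x.1 x.2) =
      ∑ z : Labels n k, (∏ i, π (z i)) * (f z + ∑ G, condWeight P z G * g z G) := by
  rw [Fintype.sum_prod_type]
  refine Finset.sum_congr rfl fun z _ => ?_
  simp_rw [mul_assoc]
  rw [← Finset.mul_sum]
  simp_rw [mul_add]
  rw [Finset.sum_add_distrib, ← Finset.sum_mul, sum_condWeight, one_mul, mul_add]

/-- Quantitative form of: with high probability all communities are large and the edge counts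
concentrate. -/
theorem law_concentrated_ge {π : Fin k → ℝ} (hπ0 : ∀ a, 0 ≤ π a) (hπ : ∑ a, π a = 1)
    {S : Matrix (Fin k) (Fin k) ℝ} {r M ε s c : ℝ} (hS : S.IsSymm)
    (h0 : ∀ a b, 0 ≤ r * S a b) (h1 : ∀ a b, r * S a b ≤ 1) (hr : 0 ≤ r) (hM : 0 < M)
    (hSM : ∀ a b, S a b ≤ M) (hε : 0 < ε) (hs : 2 ≤ s) {F : Set (Labels n k)}
    (hF : ∀ e ∈ F, ∀ a, s ≤ size e a) (hc0 : 0 ≤ c) (hc : ∀ a, c < π a) :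
    ENNReal.ofReal (1 - (∑ a, Real.exp (-(π a - c) ^ 2 / 4) ^ n + (k : ℝ) ^ n * (k ^ 2 *
        (2 * Real.exp (-(min (1 / 2) (ε / (4 * M)) * ε / 4 * (r * s ^ 2))))))) ≤
      law n π (r • S) {x | (∀ a, c * n ≤ size x.1 a) ∧ Concentrated S r ε F x.1 x.2} := by
  classical
  obtain ⟨E, hE⟩ : ∃ E : Set (Labels n k × SimpleGraph (Fin n)),
    E = {x | (∀ a, c * n ≤ size x.1 a) ∧ Concentrated S r ε F x.1 x.2} := ⟨_, rfl⟩
  rw [← hE]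
  refine ofReal_le_law (P := r • S) hπ0 hπ h0 h1 E ?_
  set B := (k : ℝ) ^ n * (k ^ 2 *
        (2 * Real.exp (-(min (1 / 2) (ε / (4 * M)) * ε / 4 * (r * s ^ 2))))) with hB
  have hπz : ∀ z : Labels n k, 0 ≤ ∏ i, π (z i) := fun z => Finset.prod_nonneg fun i _ => hπ0 _
  have step : ∀ x : Labels n k × SimpleGraph (Fin n),
      (if x ∈ E then (0 : ℝ) else 1) ≤
      (∑ a, if (size x.1 a : ℝ) < c * n then 1 else 0) +
        (if Concentrated S r ε F x.1 x.2 then 0 else 1) := by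
    intro x
    have hnn : ∀ a ∈ Finset.univ, (0 : ℝ) ≤ if (size x.1 a : ℝ) < c * n then 1 else 0 :=
      fun a _ => by split_ifs <;> norm_num
    have hnn' := Finset.sum_nonneg hnn
    by_cases hC : Concentrated S r ε F x.1 x.2
    · by_cases hz : ∀ a, c * n ≤ size x.1 a
      · rw [if_pos (by rw [hE]; exact ⟨hz, hC⟩), if_pos hC, add_zero]
        exact hnn'
      · rw [if_neg (by rw [hE]; exact fun h => hz h.1), if_pos hC, add_zero]
        push Not at hz
        obtain ⟨a, ha⟩ := hz
        refine le_trans (le_of_eq ?_) (Finset.single_le_sum hnn (Finset.mem_univ a))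
        rw [if_pos ha]
    · rw [if_neg (by rw [hE]; exact fun h => hC h.2), if_neg hC]
      linarith
  calc _ ≤ ∑ x : Labels n k × SimpleGraph (Fin n),
        (∏ i, π (x.1 i)) * condWeight (r • S) x.1 x.2 *
        ((∑ a, if (size x.1 a : ℝ) < c * n then 1 else 0) +
          (if Concentrated S r ε F x.1 x.2 then 0 else 1)) :=
        Finset.sum_le_sum fun x _ => mul_le_mul_of_nonneg_left (step x)
          (mul_nonneg (hπz _) (condWeight_nonneg h0 h1 _ _))
    _ = ∑ z : Labels n k, (∏ i, π (z i)) * ((∑ a, if (size z a : ℝ) < c * n then 1 else 0) +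
          ∑ G, condWeight (r • S) z G * (if Concentrated S r ε F z G then 0 else 1)) := by
        exact sum_weight_mul_add π
          (fun z => ∑ a, if (size z a : ℝ) < c * n then (1 : ℝ) else 0)
          (fun z G => if Concentrated S r ε F z G then (0 : ℝ) else 1)
    _ ≤ ∑ z : Labels n k, (∏ i, π (z i)) *
          ((∑ a, if (size z a : ℝ) < c * n then 1 else 0) + B) :=
        Finset.sum_le_sum fun z _ => mul_le_mul_of_nonneg_left
          (add_le_add_right (not_concentrated_le hS h0 h1 hr hM hSM hε hs hF z) _) (hπz z)
    _ = (∑ a, ∑ z : Labels n k, (∏ i, π (z i)) * if (size z a : ℝ) < c * n then 1 else 0) + B := by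
        simp_rw [mul_add, Finset.sum_add_distrib, ← Finset.sum_mul, sum_prod_labels π hπ, one_mul,
          Finset.mul_sum]
        rw [Finset.sum_comm]
    _ ≤ _ := add_le_add_left (Finset.sum_le_sum fun a _ => size_tail_le hπ0 hπ a hc0 (hc a)) _

end Concentration

/-! ### Analytic properties of `x log x` -/

section Entropy

/-- For sparse graphs the Bernoulli likelihood is a Poisson one up to second order, as `(1 - x) log
(1 - x)` lies between `-x` and `-x + x ^ 2`. -/
theorem abs_tau_sub_le {x : ℝ} (h0 : 0 ≤ x) (h1 : x ≤ 1) :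
    |tau x - (x * Real.log x - x)| ≤ x ^ 2 := by
  have h : tau x - (x * Real.log x - x) = (1 - x) * Real.log (1 - x) + x := by
    unfold tau; ring
  rw [h, abs_le]
  rcases h1.eq_or_lt with rfl | h1
  · norm_num
  · have hw : 0 < 1 - x := by linarith
    have hl := mul_le_mul_of_nonneg_left (Real.one_sub_inv_le_log_of_pos hw) hw.le
    have hu := mul_le_mul_of_nonneg_left (Real.log_le_sub_one_of_pos hw) hw.le
    rw [mul_sub, mul_inv_cancel₀ hw.ne'] at hl
    constructor
    · nlinarith [sq_nonneg x]
    · nlinarith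

/-- The Bregman divergence of `x log x` dominates `(√s - √y) ^ 2`, by `log t ≤ t - 1` at `t = √(y /
s)`. Multiplying by `(√s + √y) ^ 2 ≤ 4 * M` recovers `(s - y) ^ 2`. -/
theorem mul_log_strong_convex {s y M : ℝ} (hs : 0 < s) (hsM : s ≤ M) (hy : 0 < y) (hyM : y ≤ M) :
    y * Real.log y + (Real.log y + 1) * (s - y) + (s - y) ^ 2 / (4 * M) ≤ s * Real.log s := by
  have hM : 0 < M := hs.trans_le hsM
  set p := √s with hp
  set q := √y with hq
  have hp0 : 0 < p := Real.sqrt_pos.2 hs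
  have hq0 : 0 < q := Real.sqrt_pos.2 hy
  have hps : p ^ 2 = s := Real.sq_sqrt hs.le
  have hqy : q ^ 2 = y := Real.sq_sqrt hy.le
  have hlog : Real.log y - Real.log s = 2 * Real.log (q / p) := by
    rw [← hps, ← hqy, Real.log_div hq0.ne' hp0.ne', Real.log_pow, Real.log_pow]
    push_cast
    ring
  have h1 := Real.log_le_sub_one_of_pos (div_pos hq0 hp0)
  have h2 : p ^ 2 * (q / p) = p * q := by field_simp
  have h3 : (p - q) ^ 2 ≤ s * Real.log s - y * Real.log y - (Real.log y + 1) * (s - y) := by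
    have h4 : s * (Real.log y - Real.log s) ≤ 2 * (p * q) - 2 * s := by
      rw [hlog, ← h2, ← hps]
      nlinarith [mul_le_mul_of_nonneg_left h1 (sq_nonneg p)]
    nlinarith
  have h5 : (s - y) ^ 2 / (4 * M) ≤ (p - q) ^ 2 := by
    rw [div_le_iff₀ (by positivity)]
    have h6 : (p + q) ^ 2 ≤ 4 * M := by nlinarith [sq_nonneg (p - q)]
    calc (s - y) ^ 2 = (p - q) ^ 2 * (p + q) ^ 2 := by rw [← hps, ← hqy]; ring
      _ ≤ _ := mul_le_mul_of_nonneg_left h6 (sq_nonneg _)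
  linarith

/-- The interval contains `0` because an observed frequency may vanish; `x log x` is continuous
there too. -/
theorem exists_modulus_mul_log (M : ℝ) {δ : ℝ} (hδ : 0 < δ) :
    ∃ ε : ℝ, 0 < ε ∧ ε ≤ 1 ∧ ∀ u ∈ Set.Icc (0 : ℝ) M, ∀ y ∈ Set.Icc (0 : ℝ) M, |u - y| ≤ ε →
      |u * Real.log u - y * Real.log y| ≤ δ := by
  have hc : UniformContinuousOn (fun x : ℝ => x * Real.log x) (Set.Icc 0 M) :=
    isCompact_Icc.uniformContinuousOn_of_continuous Real.continuous_mul_log.continuousOn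
  obtain ⟨η, hη, h⟩ := Metric.uniformContinuousOn_iff.1 hc δ hδ
  refine ⟨min (η / 2) 1, lt_min (by linarith) one_pos, min_le_right _ _, ?_⟩
  intro u hu y hy huy
  have := h u hu y hy (by
    rw [Real.dist_eq]
    linarith [min_le_left (η / 2) 1])
  rw [Real.dist_eq] at this
  exact this.le

end Entropy

/-! ### The population criterion and its Jensen gap -/

section Population

variable {n k : ℕ}

/-- The population version of the likelihood modularity (up to scaling). -/
noncomputable def popEnergy (S : Matrix (Fin k) (Fin k) ℝ) (e z : Labels n k) : ℝ :=
  ∑ a, ∑ b, pairs e a b *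
    (expEdges S e z a b / pairs e a b * Real.log (expEdges S e z a b / pairs e a b))

theorem sum_cell_eq (S : Matrix (Fin k) (Fin k) ℝ) (e z : Labels n k) (a b : Fin k)
    (f : Fin n → Fin n → ℝ) (c d y : ℝ) :
    ∑ i, ∑ j, (if e i = a ∧ e j = b ∧ i ≠ j then f i j - (c + d * (S (z i) (z j) - y)) else 0) =
      (∑ i, ∑ j, (if e i = a ∧ e j = b ∧ i ≠ j then f i j else 0)) -
        (c * pairs e a b + d * (expEdges S e z a b - y * pairs e a b)) := by
  rw [pairs_eq_sum, expEdges]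
  simp_rw [Finset.mul_sum]
  simp_rw [← Finset.sum_sub_distrib]
  simp_rw [Finset.mul_sum]
  simp_rw [← Finset.sum_add_distrib]
  simp_rw [← Finset.sum_sub_distrib]
  refine Finset.sum_congr rfl fun i _ => Finset.sum_congr rfl fun j _ => ?_
  split_ifs
  · ring
  · ring

/-- Jensen with a quadratic remainder: in each cell take the tangent of `x log x` at the cell
average of `S`. The linear term then sums to zero over the cell. -/
theorem popEnergy_add_le {S : Matrix (Fin k) (Fin k) ℝ} {m M : ℝ} (hm : 0 < m)
    (hmS : ∀ a b, m ≤ S a b) (hSM : ∀ a b, S a b ≤ M) (e z : Labels n k)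
    (he : ∀ a b, 0 < pairs e a b) :
    popEnergy S e z + (∑ i, ∑ j, if i ≠ j then (S (z i) (z j) -
        expEdges S e z (e i) (e j) / pairs e (e i) (e j)) ^ 2 else 0) / (4 * M) ≤
      ∑ i, ∑ j, if i ≠ j then S (z i) (z j) * Real.log (S (z i) (z j)) else 0 := by
  rw [← sum_cells e (fun i j => i ≠ j), ← sum_cells e (fun i j => i ≠ j), popEnergy,
    Finset.sum_div, ← Finset.sum_add_distrib]
  refine Finset.sum_le_sum fun a _ => ?_
  rw [Finset.sum_div, ← Finset.sum_add_distrib]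
  refine Finset.sum_le_sum fun b _ => ?_
  have hN := he a b
  set y := expEdges S e z a b / pairs e a b with hy
  have hyN : expEdges S e z a b = y * pairs e a b := by rw [hy]; field_simp
  have hmy : m ≤ y := by rw [hy, le_div_iff₀ hN]; exact le_expEdges hmS e z a b
  have hyM : y ≤ M := by rw [hy, div_le_iff₀ hN]; exact expEdges_le hSM e z a b
  have h := sum_cell_eq S e z a b (fun i j => S (z i) (z j) * Real.log (S (z i) (z j)))
    (y * Real.log y) (Real.log y + 1) y
  rw [hyN, sub_self, mul_zero, add_zero] at h
  have h' : (∑ i, ∑ j, if e i = a ∧ e j = b ∧ i ≠ j then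
      (S (z i) (z j) - expEdges S e z (e i) (e j) / pairs e (e i) (e j)) ^ 2 else 0) / (4 * M) ≤
      ∑ i, ∑ j, (if e i = a ∧ e j = b ∧ i ≠ j then S (z i) (z j) * Real.log (S (z i) (z j)) -
        (y * Real.log y + (Real.log y + 1) * (S (z i) (z j) - y)) else 0) := by
    rw [Finset.sum_div]
    refine Finset.sum_le_sum fun i _ => ?_
    rw [Finset.sum_div]
    refine Finset.sum_le_sum fun j _ => ?_
    split_ifs with hij
    · rw [hij.1, hij.2.1, ← hy]
      have := mul_log_strong_convex (hm.trans_le (hmS (z i) (z j))) (hSM (z i) (z j))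
        (hm.trans_le hmy) hyM
      linarith
    · simp
  linarith

/-- Equality in Jensen: `S` is constant on the cells of the true labels. -/
theorem popEnergy_self {S : Matrix (Fin k) (Fin k) ℝ} (z : Labels n k)
    (hz : ∀ a b, 0 < pairs z a b) :
    popEnergy S z z =
      ∑ i, ∑ j, if i ≠ j then S (z i) (z j) * Real.log (S (z i) (z j)) else 0 := by
  rw [← sum_cells z (fun i j => i ≠ j), popEnergy]
  refine Finset.sum_congr rfl fun a _ => Finset.sum_congr rfl fun b _ => ?_
  have h1 : expEdges S z z a b = S a b * pairs z a b := by
    rw [pairs_eq_sum, expEdges]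
    simp_rw [Finset.mul_sum]
    refine Finset.sum_congr rfl fun i _ => Finset.sum_congr rfl fun j _ => ?_
    split_ifs with h
    · rw [h.1, h.2.1, mul_one]
    · simp
  rw [h1, mul_div_cancel_right₀ _ (hz a b).ne', pairs_eq_sum, mul_comm]
  simp_rw [Finset.mul_sum]
  refine Finset.sum_congr rfl fun i _ => Finset.sum_congr rfl fun j _ => ?_
  split_ifs with h
  · rw [h.1, h.2.1, mul_one]
  · simp

end Population

/-! ### From the likelihood to the population criterion -/

section Likelihood

variable {n k : ℕ}

theorem edges_nonneg (G : SimpleGraph (Fin n)) (e : Labels n k) (a b : Fin k) :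
    0 ≤ edges G e a b :=
  Finset.sum_nonneg fun i _ => Finset.sum_nonneg fun j _ => by split_ifs <;> norm_num

/-- Both sides are twice the number of edges of `G`. Hence the large coefficient `log r - 1` drops
out when two assignments are compared. -/
theorem sum_edges_eq (G : SimpleGraph (Fin n)) (e z : Labels n k) :
    ∑ a, ∑ b, edges G e a b = ∑ a, ∑ b, edges G z a b := by
  classical
  have h : ∀ e : Labels n k, ∑ a, ∑ b, edges G e a b =
      ∑ i, ∑ j, if G.Adj i j then (1 : ℝ) else 0 := fun e => by
    rw [← sum_cells e (fun i j => G.Adj i j) (fun _ _ => 1)]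
    simp only [edges]
  rw [h e, h z]

/-- Write `o / N = r * u` and `μ / N = y`. The error `r * δ` comes from replacing `u log u` by `y
log y`, the error of order `r ^ 2` from the Poisson approximation of `tau`. -/
theorem cell_likelihood_approx {o N μ r M ε δ : ℝ} (ho : 0 ≤ o) (hN : 0 < N) (hμ : 0 ≤ μ)
    (hμM : μ ≤ M * N) (hr : 0 < r) (hrM : r * (M + 1) ≤ 1) (hε1 : ε ≤ 1)
    (hφ : ∀ u ∈ Set.Icc (0 : ℝ) (M + 1), ∀ y ∈ Set.Icc (0 : ℝ) (M + 1), |u - y| ≤ ε →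
      |u * Real.log u - y * Real.log y| ≤ δ)
    (hc : |o - r * μ| ≤ ε * r * N) :
    |N * tau (o / N) - (Real.log r - 1) * o - r * (N * (μ / N * Real.log (μ / N)))| ≤
      N * (r * δ + r ^ 2 * (M + 1) ^ 2) := by
  set u := o / (r * N) with hu
  set y := μ / N with hy
  have hou : o = r * N * u := by rw [hu]; field_simp
  have hx : o / N = r * u := by rw [hu]; field_simp
  have hμy : μ = N * y := by rw [hy]; field_simp
  have hu0 : 0 ≤ u := by positivity
  have hy0 : 0 ≤ y := by positivity
  have hyM : y ≤ M := by rwa [hy, div_le_iff₀ hN]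
  have huy : |u - y| ≤ ε := by
    have : o - r * μ = (r * N) * (u - y) := by rw [hou, hμy]; ring
    rw [this, abs_mul, abs_of_pos (by positivity)] at hc
    have h2 : ε * r * N = r * N * ε := by ring
    rw [h2] at hc
    exact le_of_mul_le_mul_left hc (by positivity)
  have huM : u ≤ M + 1 := by linarith [(abs_le.1 huy).2]
  have h1 := hφ u ⟨hu0, huM⟩ y ⟨hy0, by linarith⟩ huy
  have hx1 : r * u ≤ r * (M + 1) := mul_le_mul_of_nonneg_left huM hr.le
  have h2 := abs_tau_sub_le (x := r * u) (by positivity) (by linarith)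
  have h3 : (r * u) ^ 2 ≤ r ^ 2 * (M + 1) ^ 2 := by
    rw [← mul_pow]
    exact pow_le_pow_left₀ (by positivity) hx1 2
  have h4 : r * u * Real.log (r * u) = r * u * Real.log r + r * (u * Real.log u) := by
    rcases hu0.eq_or_lt with h | h
    · rw [← h]; simp
    · rw [Real.log_mul hr.ne' h.ne']; ring
  have h5 : N * tau (o / N) - (Real.log r - 1) * o - r * (N * (y * Real.log y)) =
      N * ((tau (r * u) - (r * u * Real.log (r * u) - r * u)) +
        r * (u * Real.log u - y * Real.log y)) := by
    rw [hx, h4]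
    clear_value u
    subst hou
    ring
  rw [h5, abs_mul, abs_of_pos hN]
  refine mul_le_mul_of_nonneg_left ((abs_add_le _ _).trans ?_) hN.le
  rw [abs_mul, abs_of_pos hr]
  linarith [mul_le_mul_of_nonneg_left h1 hr.le]

theorem likelihood_approx {S : Matrix (Fin k) (Fin k) ℝ} {r M ε δ : ℝ}
    (hS0 : ∀ a b, 0 ≤ S a b) (hSM : ∀ a b, S a b ≤ M) (hM : 0 < M)
    (hr : 0 < r) (hrM : r * (M + 1) ≤ 1) (hε1 : ε ≤ 1) (hδ : 0 ≤ δ)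
    (hφ : ∀ u ∈ Set.Icc (0 : ℝ) (M + 1), ∀ y ∈ Set.Icc (0 : ℝ) (M + 1), |u - y| ≤ ε →
      |u * Real.log u - y * Real.log y| ≤ δ) (e z : Labels n k) (G : SimpleGraph (Fin n))
    (he : ∀ a b, 0 < pairs e a b)
    (hc : ∀ a b, |edges G e a b - r * expEdges S e z a b| ≤ ε * r * pairs e a b) :
    |∑ a, ∑ b, pairs e a b * tau (edges G e a b / pairs e a b) -
        (Real.log r - 1) * ∑ a, ∑ b, edges G e a b - r * popEnergy S e z| ≤
      (n : ℝ) ^ 2 * (r * δ + r ^ 2 * (M + 1) ^ 2) := by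
  have h : ∀ a b, |pairs e a b * tau (edges G e a b / pairs e a b) -
      (Real.log r - 1) * edges G e a b - r * (pairs e a b *
      (expEdges S e z a b / pairs e a b * Real.log (expEdges S e z a b / pairs e a b)))| ≤
      pairs e a b * (r * δ + r ^ 2 * (M + 1) ^ 2) := fun a b => by
    refine cell_likelihood_approx (edges_nonneg G e a b) (he a b) ?_ (expEdges_le hSM e z a b)
      hr hrM hε1 hφ (hc a b)
    simpa using le_expEdges hS0 e z a b
  have hpos : 0 ≤ r * δ + r ^ 2 * (M + 1) ^ 2 := by positivity
  refine le_trans ?_ (mul_le_mul_of_nonneg_right (sum_pairs_le e) hpos)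
  rw [popEnergy]
  simp_rw [Finset.mul_sum]
  simp_rw [← Finset.sum_sub_distrib]
  rw [Finset.sum_mul]
  refine (Finset.abs_sum_le_sum_abs _ _).trans (Finset.sum_le_sum fun a _ => ?_)
  rw [Finset.sum_mul]
  refine (Finset.abs_sum_le_sum_abs _ _).trans (Finset.sum_le_sum fun b _ => ?_)
  exact h a b

/-- An assignment whose likelihood modularity is nearly as large as that of the true labels has
nearly constant connection probabilities on its cells. -/
theorem sum_sq_le_of_likelihood_le {S : Matrix (Fin k) (Fin k) ℝ} {r m M ε δ κ : ℝ} (hm : 0 < m)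
    (hmS : ∀ a b, m ≤ S a b) (hSM : ∀ a b, S a b ≤ M) (hM : 0 < M)
    (hr : 0 < r) (hrM : r * (M + 1) ≤ 1) (hε1 : ε ≤ 1) (hδ : 0 ≤ δ)
    (hφ : ∀ u ∈ Set.Icc (0 : ℝ) (M + 1), ∀ y ∈ Set.Icc (0 : ℝ) (M + 1), |u - y| ≤ ε →
      |u * Real.log u - y * Real.log y| ≤ δ) {F : Set (Labels n k)} {e z : Labels n k}
    {G : SimpleGraph (Fin n)} (hF : ∀ e ∈ F, ∀ a b, 0 < pairs e a b)
    (hc : Concentrated S r ε F z G) (he : e ∈ F) (hz : z ∈ F)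
    (hT : ∑ a, ∑ b, pairs z a b * tau (edges G z a b / pairs z a b) ≤
      ∑ a, ∑ b, pairs e a b * tau (edges G e a b / pairs e a b) + κ) :
    (∑ i, ∑ j, if i ≠ j then (S (z i) (z j) -
        expEdges S e z (e i) (e j) / pairs e (e i) (e j)) ^ 2 else 0) ≤
      4 * M * (2 * (n : ℝ) ^ 2 * (δ + r * (M + 1) ^ 2) + κ / r) := by
  have hS0 : ∀ a b, 0 ≤ S a b := fun a b => hm.le.trans (hmS a b)
  have h1 := likelihood_approx hS0 hSM hM hr hrM hε1 hδ hφ e z G (hF e he) (hc e he)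
  have h2 := likelihood_approx hS0 hSM hM hr hrM hε1 hδ hφ z z G (hF z hz) (hc z hz)
  rw [sum_edges_eq G e z] at h1
  have h3 : r * (popEnergy S z z - popEnergy S e z) ≤
      r * (2 * (n : ℝ) ^ 2 * (δ + r * (M + 1) ^ 2) + κ / r) := by
    have e1 : r * (2 * (n : ℝ) ^ 2 * (δ + r * (M + 1) ^ 2) + κ / r) =
      2 * ((n : ℝ) ^ 2 * (r * δ + r ^ 2 * (M + 1) ^ 2)) + κ := by field_simp
    rw [e1]
    linarith [(abs_le.1 h1).2, (abs_le.1 h2).1]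
  have h4 := le_of_mul_le_mul_left h3 hr
  have h5 := popEnergy_add_le hm hmS hSM e z (hF e he)
  rw [← popEnergy_self z (hF z hz)] at h5
  rw [mul_comm, ← div_le_iff₀ (by positivity)]
  linarith

end Likelihood

/-! ### Beta integrals against maximized binomial likelihoods -/

section Beta

open ProbabilityTheory

/-- The normalization of the beta density, read backwards; beta values can then be compared through
their integrands. -/
theorem ofReal_beta_eq_lintegral {α β : ℝ} (hα : 0 < α) (hβ : 0 < β) :
    ENNReal.ofReal (beta α β) =
      ∫⁻ x in Set.Ioo (0 : ℝ) 1, ENNReal.ofReal (x ^ (α - 1) * (1 - x) ^ (β - 1)) := by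
  have hB := beta_pos hα hβ
  have h := lintegral_betaPDF_eq_one hα hβ
  rw [lintegral_betaPDF] at h
  simp_rw [mul_assoc, ENNReal.ofReal_mul (one_div_pos.2 hB).le] at h
  rw [lintegral_const_mul _ (by fun_prop)] at h
  calc ENNReal.ofReal (beta α β) = ENNReal.ofReal (beta α β) * 1 := (mul_one _).symm
    _ = _ := by
      rw [← h, ← mul_assoc, ← ENNReal.ofReal_mul hB.le, mul_one_div_cancel hB.ne',
        ENNReal.ofReal_one, one_mul]

theorem beta_le_mul_beta {α β α' β' C : ℝ} (hα : 0 < α) (hβ : 0 < β) (hα' : 0 < α')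
    (hβ' : 0 < β') (hC : 0 ≤ C)
    (h : ∀ t ∈ Set.Ioo (0 : ℝ) 1,
      t ^ (α - 1) * (1 - t) ^ (β - 1) ≤ C * (t ^ (α' - 1) * (1 - t) ^ (β' - 1))) :
    beta α β ≤ C * beta α' β' := by
  rw [← ENNReal.ofReal_le_ofReal_iff (mul_nonneg hC (beta_pos hα' hβ').le), ENNReal.ofReal_mul hC,
    ofReal_beta_eq_lintegral hα hβ, ofReal_beta_eq_lintegral hα' hβ',
    ← lintegral_const_mul _ (by fun_prop)]
  refine setLIntegral_mono' measurableSet_Ioo fun t ht => ?_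
  rw [← ENNReal.ofReal_mul hC]
  exact ENNReal.ofReal_le_ofReal (h t ht)

theorem mul_tau_eq {x y : ℝ} (hx : 0 ≤ x) (hy : 0 ≤ y) :
    (x + y) * tau (x / (x + y)) =
      x * Real.log (x / (x + y)) + y * Real.log (y / (x + y)) := by
  rcases (add_nonneg hx hy).eq_or_lt with h | h
  · have hx' : x = 0 := by linarith
    have hy' : y = 0 := by linarith
    simp [hx', hy']
  · have h1 : 1 - x / (x + y) = y / (x + y) := by
      field_simp
      ring
    rw [tau, h1]
    field_simp

/-- Used for `(x, t)` and `(y, 1 - t)` with `m = x + y`; the two corrections then add up to zero,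
giving Gibbs' inequality. -/
theorem mul_log_le_mul_log_div_add {x m t : ℝ} (hx : 0 ≤ x) (hm : 0 < m) (ht : 0 < t) :
    x * Real.log t ≤ x * Real.log (x / m) + (m * t - x) := by
  rcases hx.eq_or_lt with h | h
  · rw [← h]
    simpa using (mul_pos hm ht).le
  · have h1 : Real.log (t / (x / m)) ≤ t / (x / m) - 1 := Real.log_le_sub_one_of_pos (by positivity)
    rw [Real.log_div ht.ne' (by positivity)] at h1
    have h2 := mul_le_mul_of_nonneg_left h1 hx
    have h3 : x * (t / (x / m) - 1) = m * t - x := by field_simp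
    rw [h3] at h2
    linarith

theorem rpow_mul_rpow_le_exp_mul_tau {x y t : ℝ} (hx : 0 ≤ x) (hy : 0 ≤ y)
    (ht : t ∈ Set.Ioo (0 : ℝ) 1) :
    t ^ x * (1 - t) ^ y ≤ Real.exp ((x + y) * tau (x / (x + y))) := by
  have ht' : 0 < 1 - t := by linarith [ht.2]
  rcases (add_nonneg hx hy).eq_or_lt with h | h
  · have hx' : x = 0 := by linarith
    have hy' : y = 0 := by linarith
    simp [hx', hy']
  · rw [mul_tau_eq hx hy, Real.rpow_def_of_pos ht.1, Real.rpow_def_of_pos ht', ← Real.exp_add,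
      Real.exp_le_exp]
    have h1 := mul_log_le_mul_log_div_add hx h ht.1
    have h2 := mul_log_le_mul_log_div_add hy h ht'
    nlinarith

/-- The binomial likelihood is at most its value at the empirical frequency; integrate this against
the Beta(1/2, 1/2) weight. -/
theorem beta_add_half_le {x y : ℝ} (hx : 0 ≤ x) (hy : 0 ≤ y) :
    beta (x + 1 / 2) (y + 1 / 2) ≤
      Real.exp ((x + y) * tau (x / (x + y))) * beta (1 / 2) (1 / 2) := by
  refine beta_le_mul_beta (by linarith) (by linarith) (by norm_num) (by norm_num)
    (Real.exp_pos _).le fun t ht => ?_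
  have ht' : 0 < 1 - t := by linarith [ht.2]
  rw [show x + 1 / 2 - 1 = x + (1 / 2 - 1) by ring, show y + 1 / 2 - 1 = y + (1 / 2 - 1) by ring,
    Real.rpow_add ht.1, Real.rpow_add ht', mul_mul_mul_comm]
  exact mul_le_mul_of_nonneg_right (rpow_mul_rpow_le_exp_mul_tau hx hy ht)
    (mul_nonneg (Real.rpow_nonneg ht.1.le _) (Real.rpow_nonneg ht'.le _))

/-- Shifting to integer arguments makes the Gamma functions factorials. -/
theorem beta_add_one_le_beta_add_half {x y : ℝ} (hx : 0 ≤ x) (hy : 0 ≤ y) :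
    beta (x + 1) (y + 1) ≤ beta (x + 1 / 2) (y + 1 / 2) := by
  rw [← one_mul (beta (x + 1 / 2) (y + 1 / 2))]
  refine beta_le_mul_beta (by linarith) (by linarith) (by linarith) (by linarith)
    zero_le_one fun t ht => ?_
  have ht' : 0 < 1 - t := by linarith [ht.2]
  rw [one_mul]
  exact mul_le_mul (Real.rpow_le_rpow_of_exponent_ge ht.1 ht.2.le (by linarith))
    (Real.rpow_le_rpow_of_exponent_ge ht' (by linarith [ht.1]) (by linarith))
    (Real.rpow_nonneg ht'.le _) (Real.rpow_nonneg ht.1.le _)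

theorem exp_nat_mul_log_div {x : ℕ} {m : ℝ} (hm : 0 < m) :
    Real.exp (x * Real.log (x / m)) = (x / m) ^ x := by
  rcases Nat.eq_zero_or_pos x with rfl | hx
  · simp
  · rw [mul_comm, Real.exp_mul, Real.exp_log (by positivity), Real.rpow_natCast]

/-- The beta value is the inverse of `(x + y + 1)` times a binomial coefficient, and that
coefficient times the exponential is a single binomial probability, hence at most `1`. -/
theorem exp_mul_tau_le_beta_add_one (x y : ℕ) :
    Real.exp ((x + y : ℝ) * tau (x / (x + y))) / (x + y + 1) ≤ beta (x + 1) (y + 1) := by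
  have hB : beta (x + 1) (y + 1) =
      (x.factorial : ℝ) * y.factorial / ((x + y + 1) * (x + y).factorial) := by
    rw [beta, Real.Gamma_nat_eq_factorial, Real.Gamma_nat_eq_factorial,
      show ((x : ℝ) + 1 + (y + 1)) = ((x + y + 1 : ℕ) : ℝ) + 1 by push_cast; ring,
      Real.Gamma_nat_eq_factorial, Nat.factorial_succ]
    push_cast
    rfl
  have hchoose : ((x + y).choose x : ℝ) * (x.factorial * y.factorial) = (x + y).factorial := by
    have := Nat.choose_mul_factorial_mul_factorial (Nat.le_add_right x y)
    rw [Nat.add_sub_cancel_left] at this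
    rw [← mul_assoc]
    exact_mod_cast this
  have hmain : ((x + y).choose x : ℝ) * Real.exp ((x + y : ℝ) * tau (x / (x + y))) ≤ 1 := by
    rcases Nat.eq_zero_or_pos (x + y) with h | h
    · have hx : x = 0 := by omega
      have hy : y = 0 := by omega
      simp [hx, hy]
    · have hm : (0 : ℝ) < x + y := by exact_mod_cast h
      rw [mul_tau_eq (Nat.cast_nonneg x) (Nat.cast_nonneg y), Real.exp_add,
        exp_nat_mul_log_div hm, exp_nat_mul_log_div hm]
      have hp := add_pow ((x : ℝ) / (x + y)) (y / (x + y)) (x + y)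
      rw [← add_div, div_self hm.ne', one_pow] at hp
      have hle := Finset.single_le_sum (s := Finset.range (x + y + 1))
        (f := fun i => ((x : ℝ) / (x + y)) ^ i * (y / (x + y)) ^ (x + y - i) *
          ((x + y).choose i : ℝ)) (fun i _ => by positivity)
        (Finset.mem_range.2 (by omega : x < x + y + 1))
      rw [← hp] at hle
      simp only [Nat.add_sub_cancel_left] at hle
      linarith
  rw [hB, div_le_div_iff₀ (by positivity) (by positivity), ← hchoose]
  have hpos : (0 : ℝ) ≤ x.factorial * y.factorial * (x + y + 1) := by positivity
  calc _ = ((x + y).choose x : ℝ) * Real.exp ((x + y : ℝ) * tau (x / (x + y))) *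
        (x.factorial * y.factorial * (x + y + 1)) := by ring
    _ ≤ 1 * (x.factorial * y.factorial * (x + y + 1)) := mul_le_mul_of_nonneg_right hmain hpos
    _ = _ := by ring

theorem beta_half_half : beta (1 / 2) (1 / 2) = Real.pi := by
  rw [beta, Real.Gamma_one_half_eq, add_halves, Real.Gamma_one, div_one,
    Real.mul_self_sqrt Real.pi_pos.le]

theorem log_beta_div_le {x m : ℝ} (hx : 0 ≤ x) (hxm : x ≤ m) :
    Real.log (beta (x + 1 / 2) (m - x + 1 / 2) / beta (1 / 2) (1 / 2)) ≤ m * tau (x / m) := by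
  have hy : 0 ≤ m - x := by linarith
  have h := beta_add_half_le hx hy
  have hB : 0 < beta (1 / 2) (1 / 2) := beta_pos (by norm_num) (by norm_num)
  rw [add_sub_cancel] at h
  rw [Real.log_le_iff_le_exp (div_pos (beta_pos (by linarith) (by linarith)) hB), div_le_iff₀ hB]
  exact h

theorem le_log_beta_div {x m : ℕ} (hxm : x ≤ m) :
    m * tau (x / m) - (Real.log (m + 1) + Real.log Real.pi) ≤
      Real.log (beta (x + 1 / 2) (m - x + 1 / 2) / beta (1 / 2) (1 / 2)) := by
  obtain ⟨y, rfl⟩ := Nat.exists_eq_add_of_le hxm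
  have h1 := exp_mul_tau_le_beta_add_one x y
  have h2 := h1.trans (beta_add_one_le_beta_add_half (Nat.cast_nonneg x) (Nat.cast_nonneg y))
  have hB : 0 < beta ((x : ℝ) + 1 / 2) (y + 1 / 2) := beta_pos (by positivity) (by positivity)
  push_cast
  rw [add_sub_cancel_left, beta_half_half, Real.log_div hB.ne' Real.pi_pos.ne']
  have h3 := Real.log_le_log (by positivity) h2
  rw [Real.log_div (Real.exp_pos _).ne' (by positivity), Real.log_exp] at h3
  linarith

end Beta

/-! ### Comparison of the ICL and ML criteria -/

section ICL

variable {n k : ℕ}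

theorem edges_le_pairs (G : SimpleGraph (Fin n)) (e : Labels n k) (a b : Fin k) :
    edges G e a b ≤ pairs e a b := by
  rw [pairs_eq_sum, edges]
  refine Finset.sum_le_sum fun i _ => Finset.sum_le_sum fun j _ => ?_
  by_cases h : e i = a ∧ e j = b ∧ G.Adj i j
  · rw [if_pos h, if_pos ⟨h.1, h.2.1, h.2.2.ne⟩]
  · rw [if_neg h]
    split_ifs <;> norm_num

theorem edges_comm (G : SimpleGraph (Fin n)) (e : Labels n k) (a b : Fin k) :
    edges G e a b = edges G e b a := by
  rw [edges, Finset.sum_comm, edges]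
  refine Finset.sum_congr rfl fun i _ => Finset.sum_congr rfl fun j _ => ?_
  have h : (e j = a ∧ e i = b ∧ G.Adj j i) ↔ (e i = b ∧ e j = a ∧ G.Adj i j) := by
    rw [G.adj_comm j i]
    tauto
  by_cases hc : e i = b ∧ e j = a ∧ G.Adj i j
  · rw [if_pos (h.2 hc), if_pos hc]
  · rw [if_neg fun h2 => hc (h.1 h2), if_neg hc]

theorem pairs_comm (e : Labels n k) (a b : Fin k) : pairs e a b = pairs e b a := by
  unfold pairs
  by_cases h : a = b
  · subst h; rfl
  · rw [if_neg h, if_neg (Ne.symm h), mul_comm]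

/-- Integrality is needed for the lower beta bound, which goes through factorials. On the diagonal,
halving undoes the double count of each edge. -/
theorem exists_nat_edges' (G : SimpleGraph (Fin n)) (e : Labels n k) (a b : Fin k) :
    ∃ x : ℕ, edges' G e a b = x := by
  classical
  by_cases h : a = b
  · subst h
    refine ⟨∑ i, ∑ j ∈ Finset.Ioi i, if e i = a ∧ e j = a ∧ G.Adj i j then 1 else 0, ?_⟩
    rw [edges', if_pos rfl, edges_eq_sum_cellMult, Finset.sum_div]
    push_cast
    refine Finset.sum_congr rfl fun i _ => ?_
    rw [Finset.sum_div]
    refine Finset.sum_congr rfl fun j _ => ?_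
    unfold cellMult
    by_cases h1 : e i = a <;> by_cases h2 : e j = a <;> by_cases h3 : G.Adj i j <;>
      simp [h1, h2, h3]
  · refine ⟨∑ i, ∑ j, if e i = a ∧ e j = b ∧ G.Adj i j then 1 else 0, ?_⟩
    rw [edges', if_neg h, edges]
    push_cast
    refine Finset.sum_congr rfl fun i _ => Finset.sum_congr rfl fun j _ => by congr

theorem exists_nat_pairs' (e : Labels n k) (a b : Fin k) : ∃ m : ℕ, pairs' e a b = m := by
  by_cases h : a = b
  · subst h
    refine ⟨(size e a).choose 2, ?_⟩
    rw [pairs', if_pos rfl, pairs, if_pos rfl, Nat.cast_choose_two]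
  · exact ⟨size e a * size e b, by rw [pairs', if_neg h, pairs, if_neg h, Nat.cast_mul]⟩

theorem pairs'_le (e : Labels n k) (a b : Fin k) : pairs' e a b ≤ (n : ℝ) ^ 2 := by
  have h1 : pairs e a b ≤ ∑ a, ∑ b, pairs e a b :=
    (Finset.single_le_sum (fun b _ => pairs_nonneg e a b) (Finset.mem_univ b)).trans
      (Finset.single_le_sum (f := fun a => ∑ b, pairs e a b)
        (fun a _ => Finset.sum_nonneg fun b _ => pairs_nonneg e a b) (Finset.mem_univ a))
  have h2 := sum_pairs_le e
  have h3 := pairs_nonneg e a b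
  unfold pairs'
  split_ifs <;> linarith

theorem sum_sum_eq_two_mul_sum_Ici (h : Fin k → Fin k → ℝ) (hh : ∀ a b, h a b = h b a) :
    ∑ a, ∑ b, h a b = 2 * ∑ a, ∑ b ∈ Finset.Ici a, if a = b then h a b / 2 else h a b := by
  have h1 : ∀ a b, h a b = (if a = b then 0 else h a b) + if a = b then h a b else 0 := by
    intro a b
    split_ifs <;> simp
  calc ∑ a, ∑ b, h a b = ∑ a, ∑ b, (if a = b then 0 else h a b) + ∑ a, h a a := by
        rw [← Finset.sum_add_distrib]
        refine Finset.sum_congr rfl fun a _ => ?_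
        rw [Finset.sum_congr rfl fun b _ => h1 a b, Finset.sum_add_distrib]
        simp
    _ = _ := by
        rw [sum_sum_eq_sum_Ioi _ (by simp), ← Finset.sum_add_distrib, Finset.mul_sum]
        refine Finset.sum_congr rfl fun a _ => ?_
        rw [← Finset.Ioi_insert, Finset.sum_insert (by simp), if_pos rfl, mul_add,
          mul_div_cancel₀ _ two_ne_zero, add_comm, Finset.mul_sum]
        congr 1
        refine Finset.sum_congr rfl fun b hb => ?_
        have hab : a ≠ b := (Finset.mem_Ioi.1 hb).ne
        rw [if_neg hab, if_neg hab.symm, if_neg hab, hh b a]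
        ring

theorem sum_pairs_tau_eq (G : SimpleGraph (Fin n)) (e : Labels n k) :
    ∑ a, ∑ b, pairs e a b * tau (edges G e a b / pairs e a b) =
      2 * ∑ a, ∑ b ∈ Finset.Ici a, pairs' e a b * tau (edges' G e a b / pairs' e a b) := by
  rw [sum_sum_eq_two_mul_sum_Ici _ fun a b => by rw [edges_comm, pairs_comm]]
  congr 1
  refine Finset.sum_congr rfl fun a _ => Finset.sum_congr rfl fun b _ => ?_
  unfold pairs' edges'
  split_ifs
  · rw [div_div_div_cancel_right₀ two_ne_zero]
    ring
  · rfl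

theorem icl_bounds (G : SimpleGraph (Fin n)) (e : Labels n k) (a b : Fin k) :
    Real.log (ProbabilityTheory.beta (edges' G e a b + 1 / 2)
        (pairs' e a b - edges' G e a b + 1 / 2) / ProbabilityTheory.beta (1 / 2) (1 / 2)) ≤
      pairs' e a b * tau (edges' G e a b / pairs' e a b) ∧
    pairs' e a b * tau (edges' G e a b / pairs' e a b) -
        (Real.log ((n : ℝ) ^ 2 + 1) + Real.log Real.pi) ≤
      Real.log (ProbabilityTheory.beta (edges' G e a b + 1 / 2)
        (pairs' e a b - edges' G e a b + 1 / 2) / ProbabilityTheory.beta (1 / 2) (1 / 2)) := by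
  have hle : edges' G e a b ≤ pairs' e a b := by
    have := edges_le_pairs G e a b
    unfold edges' pairs'
    split_ifs <;> linarith
  have hm := pairs'_le e a b
  obtain ⟨x, hx⟩ := exists_nat_edges' G e a b
  obtain ⟨m, hm'⟩ := exists_nat_pairs' e a b
  rw [hx, hm'] at hle ⊢
  rw [hm'] at hm
  refine ⟨log_beta_div_le (Nat.cast_nonneg x) hle, ?_⟩
  have h1 := le_log_beta_div (Nat.cast_le.1 hle)
  have h2 : Real.log ((m : ℝ) + 1) ≤ Real.log ((n : ℝ) ^ 2 + 1) :=
    Real.log_le_log (by positivity) (by linarith)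
  linarith

theorem likelihood_le_of_QML_le (hn : 0 < n) {G : SimpleGraph (Fin n)} {e z : Labels n k}
    (h : QML G z ≤ QML G e) :
    ∑ a, ∑ b, pairs z a b * tau (edges G z a b / pairs z a b) ≤
      ∑ a, ∑ b, pairs e a b * tau (edges G e a b / pairs e a b) := by
  have hn' : (0 : ℝ) < n := by exact_mod_cast hn
  unfold QML at h
  exact le_of_mul_le_mul_left h (by positivity)

/-- The upper beta bound at `e` is free; only the lower one at `z` costs a logarithm per cell. The
factor `2` comes from passing from unordered to ordered pairs of labels. -/
theorem likelihood_le_of_QICL_le (hn : 0 < n) {G : SimpleGraph (Fin n)} {e z : Labels n k}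
    (h : QICL G z ≤ QICL G e) :
    ∑ a, ∑ b, pairs z a b * tau (edges G z a b / pairs z a b) ≤
      ∑ a, ∑ b, pairs e a b * tau (edges G e a b / pairs e a b) +
        2 * ((k : ℝ) ^ 2 * (Real.log ((n : ℝ) ^ 2 + 1) + Real.log Real.pi)) := by
  have hn' : (0 : ℝ) < n := by exact_mod_cast hn
  unfold QICL at h
  have h1 := le_of_mul_le_mul_left h (by positivity)
  rw [sum_pairs_tau_eq, sum_pairs_tau_eq]
  set L := Real.log ((n : ℝ) ^ 2 + 1) + Real.log Real.pi with hL
  have hL0 : 0 ≤ L := add_nonneg (Real.log_nonneg (by nlinarith))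
    (Real.log_nonneg (by linarith [Real.pi_gt_three]))
  have hup : ∑ a, ∑ b ∈ Finset.Ici a, Real.log (ProbabilityTheory.beta (edges' G e a b + 1 / 2)
      (pairs' e a b - edges' G e a b + 1 / 2) / ProbabilityTheory.beta (1 / 2) (1 / 2)) ≤
      ∑ a, ∑ b ∈ Finset.Ici a, pairs' e a b * tau (edges' G e a b / pairs' e a b) :=
    Finset.sum_le_sum fun a _ => Finset.sum_le_sum fun b _ => (icl_bounds G e a b).1
  have hlo : ∑ a, ∑ b ∈ Finset.Ici a,
      (pairs' z a b * tau (edges' G z a b / pairs' z a b) - L) ≤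
      ∑ a, ∑ b ∈ Finset.Ici a, Real.log (ProbabilityTheory.beta (edges' G z a b + 1 / 2)
      (pairs' z a b - edges' G z a b + 1 / 2) / ProbabilityTheory.beta (1 / 2) (1 / 2)) :=
    Finset.sum_le_sum fun a _ => Finset.sum_le_sum fun b _ => (icl_bounds G z a b).2
  have hsum : ∑ a : Fin k, ∑ b ∈ Finset.Ici a, L ≤ (k : ℝ) ^ 2 * L := by
    calc ∑ a : Fin k, ∑ b ∈ Finset.Ici a, L ≤ ∑ a : Fin k, ∑ b : Fin k, L :=
          Finset.sum_le_sum fun a _ => Finset.sum_le_sum_of_subset_of_nonneg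
            (Finset.subset_univ _) fun _ _ _ => hL0
      _ = _ := by
          simp only [Finset.sum_const, Finset.card_univ, Fintype.card_fin, nsmul_eq_mul]
          ring
  simp_rw [Finset.sum_sub_distrib] at hlo
  linarith

end ICL

/-! ### From nearly constant cells to a label permutation -/

section Confusion

variable {n k : ℕ}

/-- The number of nodes with label `a` under `e` and label `b` under `z`. -/
noncomputable def confusion (e z : Labels n k) (a b : Fin k) : ℝ :=
  ∑ i, if e i = a ∧ z i = b then 1 else 0

theorem sum_confusion (e z : Labels n k) (b : Fin k) : ∑ a, confusion e z a b = size z b := by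
  unfold confusion
  rw [Finset.sum_comm, ← sum_boole_eq_size]
  refine Finset.sum_congr rfl fun i _ => ?_
  simp [ite_and]

theorem misclassified_le (e z : Labels n k) (σ : Equiv.Perm (Fin k)) :
    (misclassified e z : ℝ) ≤ ∑ a, ∑ b, if a ≠ σ b then confusion e z a b else 0 := by
  have h1 : misclassified e z ≤ (Finset.univ.filter fun i => e i ≠ σ (z i)).card :=
    ciInf_le (OrderBot.bddBelow _) σ
  refine (Nat.cast_le.2 h1).trans (le_of_eq ?_)
  rw [← Finset.sum_boole]
  have h2 : ∀ a b, (if a ≠ σ b then confusion e z a b else 0) =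
      ∑ i, if e i = a ∧ z i = b then (if a ≠ σ b then (1 : ℝ) else 0) else 0 := by
    intro a b
    unfold confusion
    by_cases hab : a = σ b <;> simp [hab]
  simp_rw [h2]
  rw [Finset.sum_congr rfl fun a _ => Finset.sum_comm, Finset.sum_comm]
  refine Finset.sum_congr rfl fun i _ => ?_
  simp [ite_and]

/-- The subtracted `n` pays for the excluded pairs `i = j`. -/
theorem block_sum_ge (A C : Fin n → Prop) [DecidablePred A] [DecidablePred C] {x : ℝ}
    (hx : 0 ≤ x) :
    x * ((∑ i, if A i then (1 : ℝ) else 0) * (∑ j, if C j then (1 : ℝ) else 0) - n) ≤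
      ∑ i, ∑ j, if A i ∧ C j ∧ i ≠ j then x else 0 := by
  have h1 : (∑ i, if A i then (1 : ℝ) else 0) * (∑ j, if C j then (1 : ℝ) else 0) - n =
      ∑ i, ∑ j, ((if A i then (1 : ℝ) else 0) * (if C j then (1 : ℝ) else 0) -
        if i = j then 1 else 0) := by
    simp_rw [Finset.sum_sub_distrib, Finset.sum_mul_sum]
    simp
  rw [h1, Finset.mul_sum]
  refine Finset.sum_le_sum fun i _ => ?_
  rw [Finset.mul_sum]
  refine Finset.sum_le_sum fun j _ => ?_
  by_cases hij : i = j <;> by_cases hA : A i <;> by_cases hC : C j <;> simp [hij, hA, hC, hx]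
  all_goals subst hij; simp [hA, hx]

/-- The single value `W a a'` cannot be close to both `S b c` and `S b' c`: the two squared
distances add up to at least `g / 2`. Each value is taken on at least `η ^ 2 * n ^ 2 - n` pairs,
more than half of `η ^ 2 * n ^ 2`. -/
theorem sum_sq_gt_of_confusion {S W : Matrix (Fin k) (Fin k) ℝ} {g η : ℝ} (hη : 0 < η)
    (hg0 : 0 < g) (hn : 2 < η ^ 2 * n) {e z : Labels n k} {a a' b b' c : Fin k} (hbb : b ≠ b')
    (hg : g ≤ (S b c - S b' c) ^ 2) (h1 : η * n ≤ confusion e z a b)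
    (h2 : η * n ≤ confusion e z a b') (h3 : η * n ≤ confusion e z a' c) :
    g * η ^ 2 / 4 * (n : ℝ) ^ 2 <
      ∑ i, ∑ j, if i ≠ j then (S (z i) (z j) - W (e i) (e j)) ^ 2 else 0 := by
  have hn0 : (0 : ℝ) < n := by
    by_contra h
    nlinarith [sq_nonneg η, (Nat.cast_nonneg n : (0 : ℝ) ≤ n)]
  set x := (S b c - W a a') ^ 2 with hx
  set x' := (S b' c - W a a') ^ 2 with hx'
  have hxx : g / 2 ≤ x + x' := by
    rw [hx, hx']
    nlinarith [sq_nonneg (S b c - W a a' + (S b' c - W a a'))]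
  have hsum : (∑ i, ∑ j, if (e i = a ∧ z i = b) ∧ (e j = a' ∧ z j = c) ∧ i ≠ j then x else 0) +
      (∑ i, ∑ j, if (e i = a ∧ z i = b') ∧ (e j = a' ∧ z j = c) ∧ i ≠ j then x' else 0) ≤
      ∑ i, ∑ j, if i ≠ j then (S (z i) (z j) - W (e i) (e j)) ^ 2 else 0 := by
    rw [← Finset.sum_add_distrib]
    refine Finset.sum_le_sum fun i _ => ?_
    rw [← Finset.sum_add_distrib]
    refine Finset.sum_le_sum fun j _ => ?_
    by_cases hA : (e i = a ∧ z i = b) ∧ (e j = a' ∧ z j = c) ∧ i ≠ j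
    · have hB : ¬ ((e i = a ∧ z i = b') ∧ (e j = a' ∧ z j = c) ∧ i ≠ j) :=
        fun hB => hbb (hA.1.2.symm.trans hB.1.2)
      rw [if_pos hA, if_neg hB, if_pos hA.2.2, hA.1.1, hA.1.2, hA.2.1.1, hA.2.1.2, add_zero]
    · rw [if_neg hA, zero_add]
      by_cases hB : (e i = a ∧ z i = b') ∧ (e j = a' ∧ z j = c) ∧ i ≠ j
      · rw [if_pos hB, if_pos hB.2.2, hB.1.1, hB.1.2, hB.2.1.1, hB.2.1.2]
      · rw [if_neg hB]
        split_ifs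
        · exact sq_nonneg _
        · exact le_rfl
  have hb1 := block_sum_ge (fun i => e i = a ∧ z i = b) (fun j => e j = a' ∧ z j = c)
    (sq_nonneg (S b c - W a a'))
  have hb2 := block_sum_ge (fun i => e i = a ∧ z i = b') (fun j => e j = a' ∧ z j = c)
    (sq_nonneg (S b' c - W a a'))
  rw [← hx] at hb1
  rw [← hx'] at hb2
  refine lt_of_lt_of_le ?_ hsum
  refine lt_of_lt_of_le ?_ (add_le_add hb1 hb2)
  have hηn : 0 ≤ η * n := by positivity
  have m1 : η * n * (η * n) ≤ confusion e z a b * confusion e z a' c :=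
    mul_le_mul h1 h3 hηn (hηn.trans h1)
  have m2 : η * n * (η * n) ≤ confusion e z a b' * confusion e z a' c :=
    mul_le_mul h2 h3 hηn (hηn.trans h2)
  have q : η ^ 2 / 2 * (n : ℝ) ^ 2 < η * n * (η * n) - n := by nlinarith
  have hq0 : 0 ≤ η ^ 2 / 2 * (n : ℝ) ^ 2 := by positivity
  calc g * η ^ 2 / 4 * (n : ℝ) ^ 2 = g / 2 * (η ^ 2 / 2 * (n : ℝ) ^ 2) := by ring
    _ < g / 2 * (η * n * (η * n) - n) := mul_lt_mul_of_pos_left q (by linarith)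
    _ ≤ (x + x') * (η * n * (η * n) - n) := mul_le_mul_of_nonneg_right hxx (hq0.trans q.le)
    _ = x * (η * n * (η * n) - n) + x' * (η * n * (η * n) - n) := add_mul _ _ _
    _ ≤ _ := add_le_add
      (mul_le_mul_of_nonneg_left (sub_le_sub_right m1 _) (sq_nonneg _))
      (mul_le_mul_of_nonneg_left (sub_le_sub_right m2 _) (sq_nonneg _))

/-- If the connection probabilities are nearly constant on the cells of `e`, then `e` nearly
coincides with `z`, up to a permutation of the labels. -/
theorem misclassified_le_of_sum_sq_le {S W : Matrix (Fin k) (Fin k) ℝ} {g η c : ℝ}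
    (hη : 0 < η) (hg0 : 0 < g) (hn : 2 < η ^ 2 * n) (hS : S.IsSymm)
    (hg : ∀ b b', b ≠ b' → ∃ a, g ≤ (S a b - S a b') ^ 2) (hηc : k * η ≤ c)
    {e z : Labels n k} (hz : ∀ a, c * n ≤ size z a)
    (h : (∑ i, ∑ j, if i ≠ j then (S (z i) (z j) - W (e i) (e j)) ^ 2 else 0) ≤
      g * η ^ 2 / 4 * (n : ℝ) ^ 2) :
    (misclassified e z : ℝ) ≤ (k : ℝ) ^ 2 * (η * n) := by
  have hηn0 : 0 ≤ η * n := by positivity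
  -- Pigeonhole: the true class `b` has at least `c * n ≥ k * η * n` nodes, split among `k` classes
  -- of `e`.
  have hbig : ∀ b, ∃ a, η * n ≤ confusion e z a b := by
    intro b
    by_contra! hlt
    have : Nonempty (Fin k) := ⟨b⟩
    have h1 : ∑ a, confusion e z a b < ∑ _a : Fin k, η * n :=
      Finset.sum_lt_sum_of_nonempty Finset.univ_nonempty fun a _ => hlt a
    rw [sum_confusion] at h1
    simp only [Finset.sum_const, Finset.card_univ, Fintype.card_fin, nsmul_eq_mul] at h1
    have h2 := hz b
    have h3 : k * η * n ≤ c * n := mul_le_mul_of_nonneg_right hηc (Nat.cast_nonneg n)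
    linarith
  -- Take `c'` where columns `b` and `b'` differ, and a class `a'` of `e` with a large share of
  -- `c'`; the cell `(a, a')` is then far from constant.
  have huniq : ∀ a b b', η * n ≤ confusion e z a b → η * n ≤ confusion e z a b' → b = b' := by
    intro a b b' h1 h2
    by_contra hbb
    obtain ⟨c', hc'⟩ := hg b b' hbb
    obtain ⟨a', ha'⟩ := hbig c'
    rw [hS.apply b c', hS.apply b' c'] at hc'
    exact absurd h (not_le.2 (sum_sq_gt_of_confusion hη hg0 hn hbb hc' h1 h2 ha'))
  choose s hs using hbig
  have hinj : Function.Injective s := fun b b' hbb =>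
    huniq (s b) b b' (hs b) (by rw [hbb]; exact hs b')
  have hbij := Finite.injective_iff_bijective.1 hinj
  refine (misclassified_le e z (Equiv.ofBijective s hbij)).trans ?_
  calc _ ≤ ∑ a : Fin k, ∑ b : Fin k, η * n := by
        refine Finset.sum_le_sum fun a _ => Finset.sum_le_sum fun b _ => ?_
        split_ifs with hab
        -- A large overlap off the graph of `s` would give the class `s b'` two large true classes.
        · by_contra! hlt
          obtain ⟨b', rfl⟩ := hbij.2 a
          exact hab (by rw [huniq (s b') b b' hlt.le (hs b')]; rfl)
        · exact hηn0
    _ = _ := by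
        simp only [Finset.sum_const, Finset.card_univ, Fintype.card_fin, nsmul_eq_mul]
        ring

end Confusion

/-! ### Choice of constants and passage to the limit -/

section Consistency

variable {k : ℕ}

theorem exists_pos_forall_le {ι : Type*} [Finite ι] (f : ι → ℝ) (hf : ∀ i, 0 < f i) :
    ∃ m, 0 < m ∧ ∀ i, m ≤ f i := by
  cases isEmpty_or_nonempty ι
  · exact ⟨1, one_pos, fun i => isEmptyElim i⟩
  · obtain ⟨i, hi⟩ := Finite.exists_min f
    exact ⟨f i, hf i, hi⟩

theorem tendsto_mul_sq_of_isLittleO {x α : ℕ → ℝ} (hx : Tendsto x atTop atTop)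
    (h : (fun n => x n ^ (-(1 / 2) : ℝ)) =o[atTop] α) :
    Tendsto (fun n => x n * α n ^ 2) atTop atTop := by
  rw [tendsto_atTop]
  intro C
  have hC : 0 < max C 1 := lt_max_of_lt_right one_pos
  have h' := h.def (c := (√(max C 1))⁻¹) (by positivity)
  filter_upwards [h', hx.eventually_gt_atTop 0] with n h1 h2
  rw [Real.norm_of_nonneg (Real.rpow_nonneg h2.le _), Real.norm_eq_abs, Real.rpow_neg h2.le,
    ← Real.sqrt_eq_rpow] at h1
  have h3 : √(max C 1) ≤ |α n| * √(x n) := by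
    have hs : 0 < √(x n) := Real.sqrt_pos.2 h2
    have hs' : 0 < √(max C 1) := Real.sqrt_pos.2 hC
    have := mul_le_mul_of_nonneg_right h1 (mul_pos hs hs').le
    field_simp at this
    linarith
  have h4 := pow_le_pow_left₀ (Real.sqrt_nonneg _) h3 2
  rw [mul_pow, Real.sq_sqrt hC.le, Real.sq_sqrt h2.le, sq_abs] at h4
  linarith [le_max_left C 1]

/-- Once `κ * t n ≥ k + 1`, the factor `k ≤ exp k` is absorbed and `exp (-1) ^ n` remains. -/
theorem tendsto_pow_mul_exp_neg (k : ℕ) {κ : ℝ} (hκ : 0 < κ) {t : ℕ → ℝ}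
    (ht : Tendsto t atTop atTop) :
    Tendsto (fun n : ℕ => (k : ℝ) ^ n * Real.exp (-(κ * (n * t n)))) atTop (𝓝 0) := by
  have hlim : Tendsto (fun n : ℕ => Real.exp (-1) ^ n) atTop (𝓝 0) :=
    tendsto_pow_atTop_nhds_zero_of_lt_one (Real.exp_pos _).le (by simp)
  refine tendsto_of_tendsto_of_tendsto_of_le_of_le' tendsto_const_nhds hlim
    (Eventually.of_forall fun n => by positivity) ?_
  filter_upwards [ht.eventually_ge_atTop (((k : ℝ) + 1) / κ)] with n hn
  rw [div_le_iff₀ hκ] at hn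
  have h1 : (k : ℝ) ≤ Real.exp k := by linarith [Real.add_one_le_exp (k : ℝ)]
  calc (k : ℝ) ^ n * Real.exp (-(κ * (n * t n))) ≤
        Real.exp k ^ n * Real.exp (-(κ * (n * t n))) :=
        mul_le_mul_of_nonneg_right (pow_le_pow_left₀ (Nat.cast_nonneg k) h1 n) (Real.exp_pos _).le
    _ ≤ Real.exp (-1) ^ n := by
        rw [← Real.exp_nat_mul, ← Real.exp_nat_mul, ← Real.exp_add, Real.exp_le_exp]
        nlinarith [(Nat.cast_nonneg n : (0 : ℝ) ≤ n)]

theorem two_le_mul_of_four_le {n r a : ℝ} (ha : 0 < a) (hn : 1 ≤ n) (hr : r ≤ 1)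
    (h : 4 ≤ n * r * a ^ 2) : 2 ≤ a * n := by
  have h0 : 0 ≤ n * a ^ 2 := by positivity
  have h1 : 2 ^ 2 ≤ (a * n) ^ 2 := by nlinarith
  exact (pow_le_pow_iff_left₀ (by norm_num) (by positivity) two_ne_zero).1 h1

/-- Half of `Δ` is spent on the modulus of continuity and the Poisson error, a quarter each, and
half on the `C * n` discrepancy of the criterion. -/
theorem error_bound {n r M C Δ : ℝ} (hM : 0 < M) (hΔ : 0 < Δ) (hn : 0 < n) (hr : 0 < r)
    (h1 : r ≤ Δ / (32 * M) / (M + 1) ^ 2) (h2 : 8 * M * C / Δ ≤ n * r) :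
    4 * M * (2 * n ^ 2 * (Δ / (32 * M) + r * (M + 1) ^ 2) + C * n / r) ≤ Δ * n ^ 2 := by
  rw [le_div_iff₀ (by positivity)] at h1
  rw [div_le_iff₀ hΔ] at h2
  have h3 : 4 * M * (2 * n ^ 2 * (Δ / (32 * M) + r * (M + 1) ^ 2)) ≤ Δ / 2 * n ^ 2 := by
    calc _ ≤ 4 * M * (2 * n ^ 2 * (Δ / (32 * M) + Δ / (32 * M))) := by gcongr
      _ = _ := by field_simp; ring
  have h4 : 4 * M * (C * n / r) ≤ Δ / 2 * n ^ 2 := by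
    rw [← mul_div_assoc, div_le_iff₀ hr]
    linarith [mul_le_mul_of_nonneg_right h2 hn.le]
  linarith

/-- Maximizers of a criterion that controls the likelihood up to an error of order `n` are weakly
consistent. -/
theorem weaklyConsistent_of_isMaximizer {π : Fin k → ℝ} {S : Matrix (Fin k) (Fin k) ℝ}
    {ρ : ℕ → ℝ} (hπ_pos : ∀ a, 0 < π a) (hπ_sum : ∑ a, π a = 1)
    (hS_symm : S.IsSymm) (hS_pos : ∀ a b, 0 < S a b)
    (hS_col : ∀ b b', b ≠ b' → ∃ a, S a b ≠ S a b')
    (hP : ∀ n a b, 0 ≤ ρ n * S a b ∧ ρ n * S a b ≤ 1)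
    (hρ_zero : Tendsto ρ atTop (𝓝 0))
    (hρ_deg : Tendsto (fun n : ℕ => (n : ℝ) * ρ n) atTop atTop)
    {α : ℕ → ℝ} (hα : ∀ n, 0 < α n)
    (hαc : ∃ c : ℝ, (∀ a, c < π a) ∧ ∀ᶠ n in atTop, α n ≤ c)
    (hαρ : (fun n : ℕ => ((n : ℝ) * ρ n) ^ (-(1 / 2) : ℝ)) =o[atTop] α)
    {Q : ∀ n : ℕ, SimpleGraph (Fin n) → Labels n k → ℝ} {C : ℝ}
    (hQ : ∀ n, 0 < n → ∀ (G : SimpleGraph (Fin n)) (e z : Labels n k), Q n G z ≤ Q n G e →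
      ∑ a, ∑ b, pairs z a b * tau (edges G z a b / pairs z a b) ≤
        ∑ a, ∑ b, pairs e a b * tau (edges G e a b / pairs e a b) + C * n)
    {zhat : ∀ n : ℕ, SimpleGraph (Fin n) → Labels n k} (hzhat : IsMaximizer Q α zhat) :
    WeaklyConsistent π (fun n => ρ n • S) zhat := by
  intro ε hε
  have hk : 0 < k := by
    rcases Nat.eq_zero_or_pos k with rfl | h
    · simp at hπ_sum
    · exact h
  have hk' : (0 : ℝ) < k := by exact_mod_cast hk
  obtain ⟨c, hcπ, hc⟩ := hαc
  have hc0 : 0 < c := by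
    obtain ⟨n, hn⟩ := hc.exists
    exact (hα n).trans_le hn
  obtain ⟨m, hm, hmS⟩ := exists_pos_forall_le (fun p : Fin k × Fin k => S p.1 p.2)
    fun p => hS_pos _ _
  obtain ⟨g, hg0, hg⟩ : ∃ g : ℝ, 0 < g ∧ ∀ b b', b ≠ b' → ∃ a, g ≤ (S a b - S a b') ^ 2 := by
    choose a ha using hS_col
    obtain ⟨g, hg0, hg⟩ := exists_pos_forall_le
      (fun p : {p : Fin k × Fin k // p.1 ≠ p.2} =>
        (S (a _ _ p.2) p.1.1 - S (a _ _ p.2) p.1.2) ^ 2)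
      fun p => sq_pos_of_ne_zero (sub_ne_zero.2 (ha _ _ p.2))
    exact ⟨g, hg0, fun b b' hbb => ⟨a b b' hbb, hg ⟨(b, b'), hbb⟩⟩⟩
  set M := ∑ a, ∑ b, S a b with hMdef
  have hSM : ∀ a b, S a b ≤ M := fun a b =>
    (Finset.single_le_sum (fun b _ => (hS_pos a b).le) (Finset.mem_univ b)).trans
      (Finset.single_le_sum (f := fun a => ∑ b, S a b)
        (fun a _ => Finset.sum_nonneg fun b _ => (hS_pos a b).le) (Finset.mem_univ a))
  have hM : 0 < M := (hS_pos ⟨0, hk⟩ ⟨0, hk⟩).trans_le (hSM _ _)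
  -- The first bound is for the pigeonhole argument; the second makes the final error `k ^ 2 * η *
  -- n` at most `ε * n / 2`.
  set η := min (c / k) (ε / (2 * k ^ 2)) with hη_def
  have hη : 0 < η := lt_min (by positivity) (by positivity)
  have hηc : k * η ≤ c := by
    have := min_le_left (c / k) (ε / (2 * (k : ℝ) ^ 2))
    rw [← hη_def, le_div_iff₀ hk'] at this
    linarith
  have hηε : (k : ℝ) ^ 2 * η ≤ ε / 2 := by
    have := min_le_right (c / k) (ε / (2 * (k : ℝ) ^ 2))
    rw [← hη_def, le_div_iff₀ (by positivity)] at this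
    linarith
  -- The threshold of `misclassified_le_of_sum_sq_le`, per `n ^ 2`.
  set Δ := g * η ^ 2 / 4 with hΔ_def
  have hΔ : 0 < Δ := by positivity
  obtain ⟨ε', hε'0, hε'1, hφ⟩ := exists_modulus_mul_log (M + 1) (δ := Δ / (32 * M)) (by positivity)
  set κ := min (1 / 2) (ε' / (4 * M)) * ε' / 4 with hκ_def
  have hκ : 0 < κ := by
    have : 0 < min (1 / 2) (ε' / (4 * M)) := lt_min (by norm_num) (by positivity)
    positivity
  have ht := tendsto_mul_sq_of_isLittleO hρ_deg hαρ
  have hmass : ∀ n, law n π (ρ n • S) Set.univ = 1 := fun n =>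
    law_univ (fun a => (hπ_pos a).le) hπ_sum (fun a b => (hP n a b).1) (fun a b => (hP n a b).2)
  have hlower : Tendsto (fun n : ℕ => ENNReal.ofReal
      (1 - (∑ a, Real.exp (-(π a - c) ^ 2 / 4) ^ n + (k : ℝ) ^ n * (k ^ 2 *
        (2 * Real.exp (-(κ * (ρ n * (α n * n) ^ 2)))))))) atTop (𝓝 1) := by
    have h1 : Tendsto (fun n : ℕ => ∑ a, Real.exp (-(π a - c) ^ 2 / 4) ^ n) atTop (𝓝 0) := by
      rw [← Finset.sum_const_zero (s := (Finset.univ : Finset (Fin k)))]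
      refine tendsto_finsetSum _ fun a _ =>
        tendsto_pow_atTop_nhds_zero_of_lt_one (Real.exp_pos _).le ?_
      rw [Real.exp_lt_one_iff]
      have := pow_pos (sub_pos.2 (hcπ a)) 2
      linarith
    have h2 := (tendsto_pow_mul_exp_neg k hκ ht).const_mul (2 * (k : ℝ) ^ 2)
    have h3 := (h1.add h2).const_sub 1
    simp only [mul_zero, add_zero, sub_zero] at h3
    rw [← ENNReal.ofReal_one]
    refine (ENNReal.continuous_ofReal.tendsto 1).comp (h3.congr fun n => ?_)
    have e1 : κ * (n * (n * ρ n * α n ^ 2)) = κ * (ρ n * (α n * n) ^ 2) := by ring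
    rw [e1]
    ring
  refine tendsto_of_tendsto_of_tendsto_of_le_of_le' hlower tendsto_const_nhds ?_
    (Eventually.of_forall fun n => (measure_mono (Set.subset_univ _)).trans (hmass n).le)
  have hη2 : Tendsto (fun n : ℕ => η ^ 2 * (n : ℝ)) atTop atTop :=
    tendsto_natCast_atTop_atTop.const_mul_atTop (by positivity)
  have hsmall : ∀ d : ℝ, 0 < d → ∀ᶠ n in atTop, ρ n ≤ d := fun d hd =>
    (hρ_zero.eventually_lt_const hd).mono fun n h => h.le
  filter_upwards [hc, eventually_gt_atTop 0, hρ_deg.eventually_gt_atTop 0,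
    hρ_deg.eventually_ge_atTop (8 * M * C / Δ), hsmall 1 one_pos,
    hsmall (1 / (M + 1)) (by positivity), hsmall (Δ / (32 * M) / (M + 1) ^ 2) (by positivity),
    ht.eventually_ge_atTop 4, hη2.eventually_gt_atTop 2] with
    n hcn hn hdeg hdegC hρ1 hρM hρΔ ht4 hηn
  have hn' : (0 : ℝ) < n := by exact_mod_cast hn
  have hn1 : (1 : ℝ) ≤ n := by exact_mod_cast hn
  have hr : 0 < ρ n := pos_of_mul_pos_right hdeg hn'.le
  have hs := two_le_mul_of_four_le (hα n) hn1 hρ1 ht4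
  refine (law_concentrated_ge (fun a => (hπ_pos a).le) hπ_sum hS_symm
    (fun a b => (hP n a b).1) (fun a b => (hP n a b).2) hr.le hM hSM hε'0 hs
    (F := feasible n k (α n)) (fun e he a => he a) hc0.le hcπ).trans (measure_mono ?_)
  rintro ⟨z, G⟩ ⟨hz, hconc⟩
  simp only at hz hconc
  -- Since `α n ≤ c`, the true labels are feasible on this event, so the maximizer does at least as
  -- well as they do.
  have hzF : z ∈ feasible n k (α n) := fun a =>
    (mul_le_mul_of_nonneg_right hcn hn'.le).trans (hz a)
  obtain ⟨heF, hmax⟩ := hzhat n G ⟨z, hzF⟩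
  have hT := hQ n hn G _ _ (isMaxOn_iff.1 hmax z hzF)
  have hpairs : ∀ e ∈ feasible n k (α n), ∀ a b, 0 < pairs e a b := fun e he a b =>
    lt_of_lt_of_le (by nlinarith) (le_pairs hs he a b)
  have hrM : ρ n * (M + 1) ≤ 1 := by rwa [le_div_iff₀ (by positivity)] at hρM
  have hsq := sum_sq_le_of_likelihood_le (S := S) hm (fun a b => hmS (a, b)) hSM hM hr hrM hε'1
    (by positivity) hφ hpairs hconc heF hzF hT
  have hbound := error_bound hM hΔ hn' hr hρΔ hdegC
  have hmis := misclassified_le_of_sum_sq_le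
    (W := fun a b => expEdges S (zhat n G) z a b / pairs (zhat n G) a b)
    hη hg0 hηn hS_symm hg hηc hz (hsq.trans hbound)
  simp only [Set.mem_ofPred_eq]
  refine hmis.trans_lt ?_
  have : (k : ℝ) ^ 2 * η * n ≤ ε / 2 * n := mul_le_mul_of_nonneg_right hηε hn'.le
  have : 0 < ε * n := by positivity
  linarith

theorem weaklyConsistent_of_isMLEstimator {π : Fin k → ℝ} {S : Matrix (Fin k) (Fin k) ℝ}
    {ρ : ℕ → ℝ} (hπ_pos : ∀ a, 0 < π a) (hπ_sum : ∑ a, π a = 1)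
    (hS_symm : S.IsSymm) (hS_pos : ∀ a b, 0 < S a b)
    (hS_col : ∀ b b', b ≠ b' → ∃ a, S a b ≠ S a b')
    (hP : ∀ n a b, 0 ≤ ρ n * S a b ∧ ρ n * S a b ≤ 1)
    (hρ_zero : Tendsto ρ atTop (𝓝 0))
    (hρ_deg : Tendsto (fun n : ℕ => (n : ℝ) * ρ n) atTop atTop)
    {α : ℕ → ℝ} (hα : ∀ n, 0 < α n)
    (hαc : ∃ c : ℝ, (∀ a, c < π a) ∧ ∀ᶠ n in atTop, α n ≤ c)
    (hαρ : (fun n : ℕ => ((n : ℝ) * ρ n) ^ (-(1 / 2) : ℝ)) =o[atTop] α)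
    {zhat : ∀ n : ℕ, SimpleGraph (Fin n) → Labels n k} (hzhat : IsMLEstimator α zhat) :
    WeaklyConsistent π (fun n => ρ n • S) zhat := by
  refine weaklyConsistent_of_isMaximizer hπ_pos hπ_sum hS_symm hS_pos hS_col hP hρ_zero hρ_deg
    hα hαc hαρ (C := 0) (fun n hn G e z h => ?_) hzhat
  rw [zero_mul, add_zero]
  exact likelihood_le_of_QML_le hn h

theorem weaklyConsistent_of_isICLEstimator {π : Fin k → ℝ} {S : Matrix (Fin k) (Fin k) ℝ}
    {ρ : ℕ → ℝ} (hπ_pos : ∀ a, 0 < π a) (hπ_sum : ∑ a, π a = 1)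
    (hS_symm : S.IsSymm) (hS_pos : ∀ a b, 0 < S a b)
    (hS_col : ∀ b b', b ≠ b' → ∃ a, S a b ≠ S a b')
    (hP : ∀ n a b, 0 ≤ ρ n * S a b ∧ ρ n * S a b ≤ 1)
    (hρ_zero : Tendsto ρ atTop (𝓝 0))
    (hρ_deg : Tendsto (fun n : ℕ => (n : ℝ) * ρ n) atTop atTop)
    {α : ℕ → ℝ} (hα : ∀ n, 0 < α n)
    (hαc : ∃ c : ℝ, (∀ a, c < π a) ∧ ∀ᶠ n in atTop, α n ≤ c)
    (hαρ : (fun n : ℕ => ((n : ℝ) * ρ n) ^ (-(1 / 2) : ℝ)) =o[atTop] α)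
    {zhat : ∀ n : ℕ, SimpleGraph (Fin n) → Labels n k} (hzhat : IsICLEstimator α zhat) :
    WeaklyConsistent π (fun n => ρ n • S) zhat := by
  -- The crude bounds `log (n ^ 2 + 1) ≤ 2 * n` and `log π ≤ n * log π` (with the number `π`)
  -- suffice.
  refine weaklyConsistent_of_isMaximizer hπ_pos hπ_sum hS_symm hS_pos hS_col hP hρ_zero hρ_deg
    hα hαc hαρ (C := 2 * ((k : ℝ) ^ 2 * (2 + Real.log Real.pi))) (fun n hn G e z h => ?_) hzhat
  refine (likelihood_le_of_QICL_le hn h).trans (add_le_add_right ?_ _)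
  have hn1 : (1 : ℝ) ≤ n := by exact_mod_cast hn
  have hlogpi : 0 ≤ Real.log Real.pi := Real.log_nonneg (by linarith [Real.pi_gt_three])
  have h1 : Real.log ((n : ℝ) ^ 2 + 1) ≤ 2 * n := by
    calc Real.log ((n : ℝ) ^ 2 + 1) ≤ Real.log (((n : ℝ) + 1) ^ 2) :=
          Real.log_le_log (by positivity) (by nlinarith)
      _ = 2 * Real.log ((n : ℝ) + 1) := by rw [Real.log_pow]; norm_num
      _ ≤ 2 * n := by
        have := Real.log_le_sub_one_of_pos (x := (n : ℝ) + 1) (by positivity)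
        linarith
  have h2 : Real.log ((n : ℝ) ^ 2 + 1) + Real.log Real.pi ≤ (2 + Real.log Real.pi) * n := by
    nlinarith
  have h3 := mul_le_mul_of_nonneg_left h2 (by positivity : (0 : ℝ) ≤ 2 * (k : ℝ) ^ 2)
  linarith

end Consistency

end SBM

theorem theorem1 {k : ℕ} (π : Fin k → ℝ) (S : Matrix (Fin k) (Fin k) ℝ) (ρ : ℕ → ℝ)
    (hπ_pos : ∀ a, 0 < π a) (hπ_sum : ∑ a, π a = 1)
    (hS_symm : S.IsSymm) (hS_pos : ∀ a b, 0 < S a b)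
    (hS_col : ∀ b b', b ≠ b' → ∃ a, S a b ≠ S a b')
    (hP : ∀ n a b, 0 ≤ ρ n * S a b ∧ ρ n * S a b ≤ 1)
    (hρ_zero : Tendsto ρ atTop (𝓝 0))
    (hρ_deg : Tendsto (fun n : ℕ => (n : ℝ) * ρ n) atTop atTop) :
    (∀ α : ℝ, 0 < α → (∀ a, α < π a) →
      ∀ zhat : ∀ n : ℕ, SimpleGraph (Fin n) → SBM.Labels n k,
        (SBM.IsMLEstimator (fun _ => α) zhat →
          SBM.WeaklyConsistent π (fun n => ρ n • S) zhat) ∧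
        (SBM.IsICLEstimator (fun _ => α) zhat →
          SBM.WeaklyConsistent π (fun n => ρ n • S) zhat)) ∧
    (∀ α : ℕ → ℝ, (∀ n, 0 < α n) →
      (∃ c : ℝ, (∀ a, c < π a) ∧ ∀ᶠ n in atTop, α n ≤ c) →
      (fun n : ℕ => ((n : ℝ) * ρ n) ^ (-(1 / 2) : ℝ)) =o[atTop] α →
      ∀ zhat : ∀ n : ℕ, SimpleGraph (Fin n) → SBM.Labels n k,
        (SBM.IsMLEstimator α zhat →
          SBM.WeaklyConsistent π (fun n => ρ n • S) zhat) ∧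
        (SBM.IsICLEstimator α zhat →
          SBM.WeaklyConsistent π (fun n => ρ n • S) zhat)) := by

  have main : ∀ α : ℕ → ℝ, (∀ n, 0 < α n) →
      (∃ c : ℝ, (∀ a, c < π a) ∧ ∀ᶠ n in atTop, α n ≤ c) →
      (fun n : ℕ => ((n : ℝ) * ρ n) ^ (-(1 / 2) : ℝ)) =o[atTop] α →
      ∀ zhat : ∀ n : ℕ, SimpleGraph (Fin n) → SBM.Labels n k,
        (SBM.IsMLEstimator α zhat →
          SBM.WeaklyConsistent π (fun n => ρ n • S) zhat) ∧
        (SBM.IsICLEstimator α zhat →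
          SBM.WeaklyConsistent π (fun n => ρ n • S) zhat) :=
    fun α hα hαc hαρ zhat =>
      ⟨SBM.weaklyConsistent_of_isMLEstimator hπ_pos hπ_sum hS_symm hS_pos hS_col hP hρ_zero
        hρ_deg hα hαc hαρ,
      SBM.weaklyConsistent_of_isICLEstimator hπ_pos hπ_sum hS_symm hS_pos hS_col hP hρ_zero
        hρ_deg hα hαc hαρ⟩
  refine ⟨fun α hα hαπ => main (fun _ => α) (fun _ => hα)
    ⟨α, hαπ, Eventually.of_forall fun _ => le_rfl⟩ ?_, main⟩
  -- For constant `α` the rate condition only says that `(n ρ) ^ (-1/2)` tends to `0`.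
  refine (isLittleO_const_iff hα.ne').2 ?_
  exact (tendsto_rpow_neg_atTop (by norm_num)).comp hρ_deg
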